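/- **Setting.** A blockchain is divided into shards of nodes; a node is honest or malicious. Malicious nodes behave arbitrarily. The underlying sharding blockchain has *fault threshold* $v$: whenever the proportion of malicious nodes in each shard is at most $v$, then (i) *intra-shard consensus is safe*: the chain of each shard is append-only, honest nodes hold initial segments of it that only grow, and each of its blocks was found valid, on top of the chain that precedes it, by a majority of the honest nodes of the shard; honest nodes store correct block headers (Merkle roots) of all shards; (ii) *it is live*: honest nodes eventually learn all blocks and headers, and a transaction (intra- or cross-shard) that an honest node of an involved shard has proposed, and that from some time on all honest nodes of the involved shards find valid as long as they do not see it in their chain, is eventually committed in all involved shards; (iii) *the on-chain cross-shard mechanism is atomic*: a transaction committed in one of its involved shards is eventually committed in all of them, and honest nodes of involved shards learn this, correctly and eventually. **Protocol.** A table $\mathcal T$ is migrated from a source shard $\mathcal S$ to a destination shard $\mathcal D\ne\mathcal S$. *Normal mode*: $\mathcal S$ processes the data and query transactions of $\mathcal T$. *Init mode*: an honest node of $\mathcal S$ that sees the planning transaction of the scheduler on its chain eventually begins to generate metadata; from then on it rejects new data transactions of $\mathcal T$ (but accepts committed blocks) and proposes a cross-shard control transaction $(b,m)$ with a block number $b$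 and the hash $m$ of $\mathcal T$ after block $b$; honest nodes of $\mathcal S$ accept $(b,m)$ only if $m$ is correct, no data transaction of $\mathcal T$ follows block $b$, and they are in the init mode. It ends for a node of $\mathcal S$ when it learns that the transaction is committed in both shards. *Dual mode*: $\mathcal S$ again processes transactions of $\mathcal T$ and gives its data transactions consecutive sequence numbers $1,2,\dots$; off-chain, nodes of $\mathcal D$ obtain copies of $\mathcal T$, of which they accept only one whose hash is $m$, and notifications consisting of a data transaction with a Merkle proof, which they check against the stored headers of $\mathcal S$; they keep requesting what they miss, and honest nodes of $\mathcal S$ answer. A node of $\mathcal D$ with the copy proposes, and agrees on, a second cross-shard control transaction, which ends the dual mode; afterwards $\mathcal S$ rejects all transactions of $\mathcal T$ and commits a control transaction with the total number $N$ of data transactions of the dual mode. An honest node of $\mathcal D$ *takes over* $\mathcal T$, i.e. begins to process its transactions, when its chain contains the second control transaction and it holds the copy, a Merkle proof of $N$, and all $N$ data transactions. Off-chain messages may be lost, delayed, duplicated or forged, but a message that one honest node sends to another infinitely often is received infinitely often. **Theorem 2.** Suppose that the honest nodes follow the protocol, that no two distinct values hashed by honest nodes in the execution collide, and that the proportion of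 malicious nodes in each shard is at most the fault threshold $v$. Then the migration is secure: 1. *Safety.* There is one serial order of all committed data and query transactions of $\mathcal T$ (in all shards), extended only at its end as time passes and compatible with the order of each chain, such that - *(serializable isolation)* every recorded query result is the result in the serial execution, and at any time the copy of $\mathcal T$ at each honest node of $\mathcal S$ or $\mathcal D$ is the outcome of an initial segment of the order; - *(durability)* committed transactions stay committed, and the copy of $\mathcal T$ at each honest node of $\mathcal D$ that has taken over is the outcome of an initial segment of the order that contains all transactions of $\mathcal T$ ever committed in $\mathcal S$ and those of $\mathcal D$ that the node has seen. 2. *Liveness.* If the planning transaction is committed in $\mathcal S$, the migration terminates: from some time on, all three control transactions are committed, every honest node of $\mathcal S$ has given up $\mathcal T$, and every honest node of $\mathcal D$ has taken it over. -/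

import Mathlib

open Filter

universe u

namespace GriDB

/-! ## Data model, transactions, hashing and Merkle trees -/

/-- The static data: shards and their nodes, the data model of the migrating table (contents, data
statements with their effect, queries with their results), the source shard that holds the table,
the destination shard, and the contents of the table before the first block. -/
structure Setting where
  Shard : Type u
  Node : Type u
  finiteNode : Finite Node
  shardOf : Node → Shard
  Table : Type u
  Op : Type u
  Query : Type u
  Res : Type u
  apply : Op → Table → Table
  eval : Query → Table → Res
  Digest : Type u
  /-- payloads of transactions that do not concern the migrating table -/
  Payload : Type u
  source : Shard
  dest : Shard
  source_ne_dest : source ≠ dest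
  genesis : Table

/-- Blockchain transactions. -/
inductive Tx (P : Setting.{u}) : Type u
  /-- a data transaction of the table, addressed to a shard; it carries a sequence number exactly
  when it is committed by the source in the dual mode -/
  | data (s : P.Shard) (op : P.Op) (seq : Option ℕ)
  /-- a query transaction of the table together with the recorded result -/
  | query (s : P.Shard) (q : P.Query) (r : P.Res)
  /-- the planning transaction of the scheduler that moves the table from `source` to `dest` -/
  | plan
  /-- the cross-shard control transaction that ends the init mode: checkpoint (a number of blocks
  of the source chain) and metadata of the table at that checkpoint -/
  | initCtrl (b : ℕ) (m : P.Digest)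
  /-- the cross-shard control transaction that ends the dual mode -/
  | dualCtrl
  /-- the control transaction of the source with the number of data transactions of the dual mode -/
  | totalCtrl (N : ℕ)
  /-- any other transaction, with the set of shards that it involves -/
  | other (R : Set P.Shard) (a : P.Payload)

variable {P : Setting.{u}}

/-- The shards that a transaction involves. -/
def Tx.related : Tx P → Set P.Shard
  | .data s _ _ => {s}
  | .query s _ _ => {s}
  | .plan => Set.univ
  | .initCtrl _ _ => {P.source, P.dest}
  | .dualCtrl => {P.source, P.dest}
  | .totalCtrl _ => {P.source}
  | .other R _ => R

/-- `x` is a data or query transaction of the table, addressed to shard `s`. -/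
def Tx.IsTableTxOf (s : P.Shard) : Tx P → Prop
  | .data s' _ _ => s' = s
  | .query s' _ _ => s' = s
  | _ => False

/-- `x` is a data or query transaction of the table. -/
def Tx.IsTableTx (x : Tx P) : Prop := ∃ s, x.IsTableTxOf s

/-- The statement of a data transaction. -/
def Tx.op? : Tx P → Option P.Op
  | .data _ op _ => some op
  | _ => none

/-- The sequence number of a data transaction. -/
def Tx.seq? : Tx P → Option ℕ
  | .data _ _ seq => seq
  | _ => none

abbrev Block (P : Setting.{u}) := List (Tx P)

/-- The data statements in a list of transactions, in order. -/
def ops (l : List (Tx P)) : List P.Op := l.filterMap Tx.op?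

/-- The number of data transactions with a sequence number. -/
def dualCount (l : List (Tx P)) : ℕ := (l.filterMap Tx.seq?).length

/-- Serial execution of data statements. -/
def run (T : P.Table) (l : List P.Op) : P.Table := l.foldl (fun s o => P.apply o s) T

/-- The table after serial execution of a list of transactions from the genesis table. -/
def tableAfter (l : List (Tx P)) : P.Table := run P.genesis (ops l)

/-- What is hashed, with domain separation. -/
inductive HashInput (P : Setting.{u}) : Type u
  | empty
  | leaf (x : Tx P)
  | node (l r : P.Digest)
  | table (T : P.Table)

abbrev Hash (P : Setting.{u}) := HashInput P → P.Digest

/-- The Merkle root of the transactions of a block. -/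
def merkleRoot (H : Hash P) : Block P → P.Digest
  | [] => H .empty
  | [x] => H (.leaf x)
  | x :: y :: l =>
    H (.node (merkleRoot H ((x :: y :: l).take ((l.length + 2) / 2)))
      (merkleRoot H ((x :: y :: l).drop ((l.length + 2) / 2))))
termination_by B => B.length
decreasing_by all_goals (simp; try omega)

/-- The hash inputs in the computation of a Merkle root. -/
def merkleInputs (H : Hash P) : Block P → Set (HashInput P)
  | [] => {.empty}
  | [x] => {.leaf x}
  | x :: y :: l =>
    {.node (merkleRoot H ((x :: y :: l).take ((l.length + 2) / 2)))
      (merkleRoot H ((x :: y :: l).drop ((l.length + 2) / 2)))} ∪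
    (merkleInputs H ((x :: y :: l).take ((l.length + 2) / 2)) ∪
      merkleInputs H ((x :: y :: l).drop ((l.length + 2) / 2)))
termination_by B => B.length
decreasing_by all_goals (simp; try omega)

/-- A Merkle proof: the siblings from the leaf up to the root; the flag says that the sibling is on
the left. -/
abbrev MerklePath (P : Setting.{u}) := List (Bool × P.Digest)

/-- The Merkle proof of the transaction at position `i` of a block. -/
def merklePath (H : Hash P) : Block P → ℕ → MerklePath P
  | [], _ => []
  | [_], _ => []
  | x :: y :: l, i =>
    if i < (l.length + 2) / 2 then
      merklePath H ((x :: y :: l).take ((l.length + 2) / 2)) i ++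
        [(false, merkleRoot H ((x :: y :: l).drop ((l.length + 2) / 2)))]
    else
      merklePath H ((x :: y :: l).drop ((l.length + 2) / 2)) (i - (l.length + 2) / 2) ++
        [(true, merkleRoot H ((x :: y :: l).take ((l.length + 2) / 2)))]
termination_by B => B.length
decreasing_by all_goals (simp; try omega)

/-- Hash one step up. -/
def stepInput (d : P.Digest) (s : Bool × P.Digest) : HashInput P :=
  if s.1 then .node s.2 d else .node d s.2

/-- The root that a Merkle proof yields from the digest of the leaf. -/
def climb (H : Hash P) : P.Digest → MerklePath P → P.Digest
  | d, [] => d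
  | d, s :: l => climb H (H (stepInput d s)) l

/-- The hash inputs in the evaluation of a Merkle proof, above the leaf. -/
def climbInputs (H : Hash P) : P.Digest → MerklePath P → Set (HashInput P)
  | _, [] => ∅
  | d, s :: l => {stepInput d s} ∪ climbInputs H (H (stepInput d s)) l

/-- The root that is computed from a transaction and a Merkle proof. -/
def proofRoot (H : Hash P) (x : Tx P) (path : MerklePath P) : P.Digest :=
  climb H (H (.leaf x)) path

/-- The hash inputs in the check of a Merkle proof for a transaction. -/
def proofInputs (H : Hash P) (x : Tx P) (path : MerklePath P) : Set (HashInput P) :=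
  {.leaf x} ∪ climbInputs H (H (.leaf x)) path

/-! ## The underlying sharding blockchain -/

/-- What happens on the underlying sharding blockchain in one (infinite) execution. -/
structure ChainRun (P : Setting.{u}) where
  /-- the malicious nodes -/
  malicious : Set P.Node
  /-- the blocks committed by a shard up to time `t` -/
  ledger : P.Shard → ℕ → List (Block P)
  /-- the blocks of its own shard that a node has accepted at time `t` -/
  view : P.Node → ℕ → List (Block P)
  /-- the block headers (Merkle roots) of a shard that a node stores at time `t` -/
  headers : P.Node → P.Shard → ℕ → List P.Digest
  /-- at time `t` the node agrees on this block as the next one after its current view -/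
  endorses : P.Node → ℕ → Block P → Prop
  /-- at time `t` the node proposes this transaction -/
  proposes : P.Node → ℕ → Tx P → Prop
  /-- by time `t` the on-chain cross-shard mechanism has shown to the node that the transaction is
  committed in all shards that it involves -/
  confirmed : P.Node → ℕ → Tx P → Prop

namespace ChainRun

variable (r : ChainRun P)

def Honest (n : P.Node) : Prop := n ∉ r.malicious

/-- The honest nodes of a shard. -/
def honestIn (s : P.Shard) : Set P.Node := {n | P.shardOf n = s ∧ r.Honest n}

/-- The transactions committed by a shard up to time `t`, in order. -/
def committed (s : P.Shard) (t : ℕ) : List (Tx P) := (r.ledger s t).flatten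

/-- The transactions in the view of a node. -/
def seen (n : P.Node) (t : ℕ) : List (Tx P) := (r.view n t).flatten

/-- In every shard the proportion of malicious nodes is at most `v`. -/
def MaliciousAtMost (v : ℝ) : Prop :=
  ∀ s, (({n | P.shardOf n = s ∧ n ∈ r.malicious} : Set P.Node).ncard : ℝ) ≤
    v * (({n | P.shardOf n = s} : Set P.Node).ncard : ℝ)

/-- Safety of the intra-shard consensus: the chain of a shard is append-only; honest nodes agree on
it block by block; and every block of it was found valid, on top of the chain that precedes it, by a
majority of the honest nodes of the shard. Headers of all shards are stored correctly. -/
structure ConsensusSafety (H : Hash P) : Prop where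
  ledger_mono : ∀ s t t', t ≤ t' → r.ledger s t <+: r.ledger s t'
  view_le : ∀ n, r.Honest n → ∀ t, r.view n t <+: r.ledger (P.shardOf n) t
  view_mono : ∀ n, r.Honest n → ∀ t t', t ≤ t' → r.view n t <+: r.view n t'
  endorsed : ∀ s t c B, c ++ [B] <+: r.ledger s t →
    (r.honestIn s).ncard <
      2 * {n ∈ r.honestIn s | ∃ t' ≤ t, r.view n t' = c ∧ r.endorses n t' B}.ncard
  headers_le : ∀ n, r.Honest n → ∀ s t,
    r.headers n s t <+: (r.ledger s t).map (merkleRoot H)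
  headers_mono : ∀ n, r.Honest n → ∀ s t t', t ≤ t' → r.headers n s t <+: r.headers n s t'

/-- Liveness of the intra-shard consensus and of the cross-shard mechanism: honest nodes eventually
learn every committed block and every header; a transaction that an honest node of an involved
shard has proposed, and that from some time on each honest node of each involved shard is ready to
agree on as long as it does not see it in its chain, is eventually committed in all shards that it
involves. -/
structure ConsensusLiveness (H : Hash P) : Prop where
  catch_up : ∀ n, r.Honest n → ∀ t, ∃ t', r.ledger (P.shardOf n) t <+: r.view n t'
  headers_catch_up : ∀ n, r.Honest n → ∀ s t, ∃ t',
    (r.ledger s t).map (merkleRoot H) <+: r.headers n s t'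
  commits : ∀ x n t₀, r.Honest n → P.shardOf n ∈ x.related → r.proposes n t₀ x →
    (∃ t₁, ∀ t ≥ t₁, ∀ n', r.Honest n' → P.shardOf n' ∈ x.related →
      x ∉ r.seen n' t → r.endorses n' t [x]) →
    ∀ s ∈ x.related, ∃ t, x ∈ r.committed s t

/-- The on-chain cross-shard mechanism: atomicity, and honest nodes learn correctly and eventually
which transactions are committed in all shards that they involve. -/
structure CrossShardAtomicity : Prop where
  atomic : ∀ x s t, s ∈ x.related → x ∈ r.committed s t →
    ∀ s' ∈ x.related, ∃ t', x ∈ r.committed s' t'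
  confirmed_sound : ∀ n, r.Honest n → ∀ t x, r.confirmed n t x →
    ∀ s ∈ x.related, x ∈ r.committed s t
  confirmed_mono : ∀ n, r.Honest n → ∀ t t' x, t ≤ t' → r.confirmed n t x → r.confirmed n t' x
  confirmed_live : ∀ n, r.Honest n → ∀ x, P.shardOf n ∈ x.related →
    (∀ s ∈ x.related, ∃ t, x ∈ r.committed s t) → ∃ t, r.confirmed n t x

end ChainRun

/-- A sharding blockchain, given by its possible executions, has fault threshold `v`: whenever the
proportion of malicious nodes is at most `v` in every shard, its intra-shard consensus is safe and
live and its cross-shard mechanism is atomic and live. -/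
def HasFaultThreshold (H : Hash P) (chain : Set (ChainRun P)) (v : ℝ) : Prop :=
  ∀ r ∈ chain, r.MaliciousAtMost v →
    r.ConsensusSafety H ∧ r.ConsensusLiveness H ∧ r.CrossShardAtomicity

/-! ## The migration protocol -/

/-- Off-chain messages. -/
inductive Msg (P : Setting.{u}) : Type u
  /-- a copy of the table -/
  | table (T : P.Table)
  /-- a transaction with its Merkle proof in block number `j` (from 0) of the source chain -/
  | incl (x : Tx P) (j : ℕ) (path : MerklePath P)
  | reqTable
  | reqUpdate (k : ℕ)
  | reqTotal

/-- An execution of the whole system: the sharding blockchain, the off-chain messages, and what the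
nodes decide locally. Nothing ties the deliveries to the sendings: messages may be lost, duplicated,
delayed and forged. -/
structure Execution (P : Setting.{u}) extends ChainRun P where
  /-- the first node sends a message to the second one at time `t` -/
  sends : P.Node → P.Node → ℕ → Msg P → Prop
  /-- the second node receives a message, seemingly from the first one, at time `t` -/
  delivered : P.Node → P.Node → ℕ → Msg P → Prop
  /-- by time `t` the node has begun to generate the metadata of the table -/
  started : P.Node → ℕ → Prop
  /-- ordinary validity of data, query, planning and unrelated transactions, as judged by the node
  at time `t` after the given transactions of the block under consideration -/
  ordinaryOK : P.Node → ℕ → List (Tx P) → Tx P → Prop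

/-- The modes of the table at the source. -/
inductive Mode
  | normal
  | init
  | dual
  | ended

namespace Execution

variable (H : Hash P) (e : Execution P)

/-- The node has received the message by time `t`. -/
def Received (n : P.Node) (t : ℕ) (msg : Msg P) : Prop :=
  ∃ t' ≤ t, ∃ n', e.delivered n' n t' msg

open Classical in
/-- The mode of the table for a source node at time `t`, after the transactions `p`. -/
noncomputable def sourceMode (n : P.Node) (t : ℕ) (p : List (Tx P)) : Mode :=
  if Tx.dualCtrl ∈ p then .ended
  else if ∃ b m, Tx.initCtrl b m ∈ p then
    if ∃ b m, Tx.initCtrl b m ∈ p ∧ e.confirmed n t (.initCtrl b m) then .dual else .init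
  else if e.started n t then .init
  else .normal

/-- The metadata of the table after the given blocks of the source chain. -/
def metadata (c : List (Block P)) : P.Digest := H (.table (tableAfter c.flatten))

/-- A source node, whose view is followed by the transactions `pre` of the same block, agrees on
`x`. -/
def SourceOK (n : P.Node) (t : ℕ) (pre : List (Tx P)) : Tx P → Prop
  | .data s op seq =>
    s = P.source ∧ e.ordinaryOK n t pre (.data s op seq) ∧
    ((e.sourceMode n t (e.seen n t ++ pre) = .normal ∧ seq = none) ∨
      (e.sourceMode n t (e.seen n t ++ pre) = .dual ∧
        seq = some (dualCount (e.seen n t ++ pre) + 1)))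
  | .query s q r =>
    s = P.source ∧ e.ordinaryOK n t pre (.query s q r) ∧
    e.sourceMode n t (e.seen n t ++ pre) ≠ .ended ∧
    r = P.eval q (tableAfter (e.seen n t ++ pre))
  | .initCtrl b m =>
    e.sourceMode n t (e.seen n t ++ pre) = .init ∧
    (∀ b' m', Tx.initCtrl b' m' ∉ e.seen n t ++ pre) ∧
    b ≤ (e.view n t).length ∧ m = metadata H ((e.view n t).take b) ∧
    ops (((e.view n t).drop b).flatten ++ pre) = []
  | .dualCtrl => e.sourceMode n t (e.seen n t ++ pre) = .dual
  | .totalCtrl N =>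
    e.sourceMode n t (e.seen n t ++ pre) = .ended ∧ e.confirmed n t .dualCtrl ∧
    (∀ N', Tx.totalCtrl N' ∉ e.seen n t ++ pre) ∧ N = dualCount (e.seen n t ++ pre)
  | .plan => e.ordinaryOK n t pre .plan
  | .other R a => P.source ∈ R ∧ e.ordinaryOK n t pre (.other R a)

/-- The node holds a Merkle proof for `x` that matches a stored header of the source chain. -/
def HoldsProof (n : P.Node) (t : ℕ) (x : Tx P) : Prop :=
  ∃ j path, e.Received n t (.incl x j path) ∧
    (e.headers n P.source t)[j]? = some (proofRoot H x path)

/-- A destination node, in the chain `p`, has downloaded a table that matches the metadata in the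
committed control transaction. -/
def HoldsCopy (n : P.Node) (t : ℕ) (p : List (Tx P)) (T : P.Table) : Prop :=
  ∃ b m, Tx.initCtrl b m ∈ p ∧ e.confirmed n t (.initCtrl b m) ∧
    e.Received n t (.table T) ∧ H (.table T) = m

/-- The node holds the data transactions of the dual mode with sequence numbers `1, …, l.length`. -/
def HoldsUpdates (n : P.Node) (t : ℕ) (l : List P.Op) : Prop :=
  ∀ k op, l[k]? = some op → e.HoldsProof H n t (.data P.source op (some (k + 1)))

/-- A destination node, in the chain `p`, has full ownership of the table, with contents `T`: the
dual mode has ended, and it has the copy, the total number and all updates of the dual mode. -/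
def Serves (n : P.Node) (t : ℕ) (p : List (Tx P)) (T : P.Table) : Prop :=
  Tx.dualCtrl ∈ p ∧ ∃ T₀ l, e.HoldsCopy H n t p T₀ ∧ e.HoldsUpdates H n t l ∧
    e.HoldsProof H n t (.totalCtrl l.length) ∧ T = run T₀ (l ++ ops p)

/-- A destination node agrees on `x` after its view and the transactions `pre` of the same block. -/
def DestOK (n : P.Node) (t : ℕ) (pre : List (Tx P)) : Tx P → Prop
  | .data s op seq =>
    s = P.dest ∧ e.ordinaryOK n t pre (.data s op seq) ∧ seq = none ∧
    ∃ T, e.Serves H n t (e.seen n t ++ pre) T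
  | .query s q r =>
    s = P.dest ∧ e.ordinaryOK n t pre (.query s q r) ∧
    ∃ T, e.Serves H n t (e.seen n t ++ pre) T ∧ r = P.eval q T
  | .initCtrl _ _ => ∀ b m, Tx.initCtrl b m ∉ e.seen n t ++ pre
  | .dualCtrl =>
    Tx.dualCtrl ∉ e.seen n t ++ pre ∧ ∃ T, e.HoldsCopy H n t (e.seen n t ++ pre) T
  | .totalCtrl _ => False
  | .plan => e.ordinaryOK n t pre .plan
  | .other R a => P.dest ∈ R ∧ e.ordinaryOK n t pre (.other R a)

/-- A node of a shard that does not take part in the migration agrees on `x`. -/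
def BystanderOK (n : P.Node) (t : ℕ) (pre : List (Tx P)) : Tx P → Prop
  | .plan => e.ordinaryOK n t pre .plan
  | .other R a => P.shardOf n ∈ R ∧ e.ordinaryOK n t pre (.other R a)
  | _ => False

/-- The node agrees on all transactions of the block, one after the other. -/
def BlockOK (n : P.Node) (t : ℕ) (B : Block P) : Prop :=
  ∀ pre x post, B = pre ++ x :: post →
    (P.shardOf n = P.source → e.SourceOK H n t pre x) ∧
    (P.shardOf n = P.dest → e.DestOK H n t pre x) ∧
    (P.shardOf n ≠ P.source → P.shardOf n ≠ P.dest → e.BystanderOK n t pre x)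

/-- What an honest source node does besides voting. -/
structure SourceRules (n : P.Node) : Prop where
  started_mono : ∀ t t', t ≤ t' → e.started n t → e.started n t'
  started_plan : ∀ t, e.started n t → Tx.plan ∈ e.seen n t
  starts : ∀ t, Tx.plan ∈ e.seen n t → ∃ t', e.started n t'
  /-- in the init mode it proposes the control transaction with up-to-date metadata -/
  proposes_init : ∀ t, e.started n t → ∃ t' ≥ t,
    (∃ b m, Tx.initCtrl b m ∈ e.seen n t') ∨
    e.proposes n t' (.initCtrl (e.view n t').length (metadata H (e.view n t')))
  /-- after the dual mode it proposes the total number of its data transactions -/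
  proposes_total : ∀ t, Tx.dualCtrl ∈ e.seen n t → e.confirmed n t .dualCtrl → ∃ t' ≥ t,
    (∃ N, Tx.totalCtrl N ∈ e.seen n t') ∨
    e.proposes n t' (.totalCtrl (dualCount (e.seen n t')))
  /-- it answers a request for the table with the table at the checkpoint -/
  replies_table : ∀ t n' b m, e.delivered n' n t .reqTable → Tx.initCtrl b m ∈ e.seen n t →
    ∃ t' ≥ t, e.sends n n' t' (.table (tableAfter ((e.view n t).take b).flatten))
  /-- it answers a request for a data transaction of the dual mode with a Merkle proof -/
  replies_update : ∀ t n' k, e.delivered n' n t (.reqUpdate k) → ∀ j B i op,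
    (e.view n t)[j]? = some B → B[i]? = some (.data P.source op (some k)) →
    ∃ t' ≥ t, e.sends n n' t' (.incl (.data P.source op (some k)) j (merklePath H B i))
  /-- it answers a request for the total number with a Merkle proof -/
  replies_total : ∀ t n', e.delivered n' n t .reqTotal → ∀ j B i N,
    (e.view n t)[j]? = some B → B[i]? = some (.totalCtrl N) →
    ∃ t' ≥ t, e.sends n n' t' (.incl (.totalCtrl N) j (merklePath H B i))

/-- What an honest destination node does besides voting: it keeps requesting what it misses from the
source nodes, and proposes to end the dual mode once it has the table. -/
structure DestRules (n : P.Node) : Prop where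
  requests_table : ∀ t b m, Tx.initCtrl b m ∈ e.seen n t → e.confirmed n t (.initCtrl b m) →
    ∀ n', P.shardOf n' = P.source → ∃ t' ≥ t,
      (∃ T, e.HoldsCopy H n t' (e.seen n t') T) ∨ e.sends n n' t' .reqTable
  proposes_dual : ∀ t T, e.HoldsCopy H n t (e.seen n t) T → ∃ t' ≥ t,
    Tx.dualCtrl ∈ e.seen n t' ∨ e.proposes n t' .dualCtrl
  requests_total : ∀ t, Tx.dualCtrl ∈ e.seen n t →
    ∀ n', P.shardOf n' = P.source → ∃ t' ≥ t,
      (∃ N, e.HoldsProof H n t' (.totalCtrl N)) ∨ e.sends n n' t' .reqTotal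
  requests_update : ∀ t N k, e.HoldsProof H n t (.totalCtrl N) → 1 ≤ k → k ≤ N →
    ∀ n', P.shardOf n' = P.source → ∃ t' ≥ t,
      (∃ op, e.HoldsProof H n t' (.data P.source op (some k))) ∨ e.sends n n' t' (.reqUpdate k)

/-- The honest nodes follow the migration protocol; nothing is said about malicious nodes. -/
structure FollowsProtocol : Prop where
  votes : ∀ n, e.Honest n → ∀ t B, e.endorses n t B ↔ e.BlockOK H n t B
  source : ∀ n, e.Honest n → P.shardOf n = P.source → e.SourceRules H n
  dest : ∀ n, e.Honest n → P.shardOf n = P.dest → e.DestRules H n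

/-- Off-chain links between honest nodes may lose messages, but a message that is sent again and
again is received again and again. -/
def FairLinks : Prop :=
  ∀ n n' msg, e.Honest n → e.Honest n' →
    (∃ᶠ t in atTop, e.sends n n' t msg) → ∃ᶠ t in atTop, e.delivered n n' t msg

/-- Everything that honest nodes hash in the execution: the blocks of the source chain, the table at
the checkpoints, and the tables and Merkle proofs that honest nodes receive. -/
def hashed : Set (HashInput P) :=
  {h | (∃ t, ∃ B ∈ e.ledger P.source t, h ∈ merkleInputs H B) ∨
    (∃ t b, h = .table (tableAfter ((e.ledger P.source t).take b).flatten)) ∨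
    (∃ n t T, e.Honest n ∧ e.Received n t (.table T) ∧ h = .table T) ∨
    (∃ n t x j path, e.Honest n ∧ e.Received n t (.incl x j path) ∧ h ∈ proofInputs H x path)}

/-- No hash collision occurs in the execution. -/
def NoCollision : Prop := Set.InjOn H (e.hashed H)

/-! ## Security -/

open Classical in
/-- The data and query transactions of the table in a list of transactions. -/
noncomputable def tableTxs (l : List (Tx P)) : List (Tx P) := l.filter fun x => x.IsTableTx

open Classical in
/-- The transactions of the table that are addressed to shard `s`. -/
noncomputable def ofShard (s : P.Shard) (l : List (Tx P)) : List (Tx P) :=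
  l.filter fun x => x.IsTableTxOf s

/-- `T` is the local copy of the table that node `n` of the source or of the destination has built
at time `t`. -/
def Replica (n : P.Node) (t : ℕ) (T : P.Table) : Prop :=
  (P.shardOf n = P.source ∧ T = tableAfter (e.seen n t)) ∨
  (P.shardOf n = P.dest ∧
    ((∃ T₀ l, e.HoldsCopy H n t (e.seen n t) T₀ ∧ e.HoldsUpdates H n t l ∧ T = run T₀ l) ∨
      e.Serves H n t (e.seen n t) T))

/-- Serializable isolation with serial order `ord`: the transactions of the table that are committed
up to time `t`, in whichever shard, form one sequence `ord t`, which only grows at its end and keeps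
the order of each chain; every recorded query result is the one of the serial execution; and the
copy of the table at each honest node is the outcome of an initial segment of it. -/
structure SerializableIsolation (ord : ℕ → List (Tx P)) : Prop where
  mono : ∀ t t', t ≤ t' → ord t <+: ord t'
  only : ∀ t, ∀ x ∈ ord t, x.IsTableTx
  complete : ∀ s t, ofShard s (ord t) = tableTxs (e.committed s t)
  legal : ∀ t p s q r l, ord t = p ++ Tx.query s q r :: l → r = P.eval q (tableAfter p)
  replicas : ∀ n t T, e.Honest n → e.Replica H n t T → ∃ p, p <+: ord t ∧ T = tableAfter p

/-- Durability: committed transactions stay committed, and the table of an honest destination node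
that has taken over reflects all transactions of the table that the source ever commits and those
of the destination that the node has seen. -/
structure Durability (ord : ℕ → List (Tx P)) : Prop where
  keeps : ∀ s t t', t ≤ t' → e.committed s t <+: e.committed s t'
  reflects : ∀ n t T, e.Honest n → P.shardOf n = P.dest → e.Serves H n t (e.seen n t) T →
    ∃ p, p <+: ord t ∧ T = tableAfter p ∧
      (∀ t', tableTxs (e.committed P.source t') <+: ofShard P.source p) ∧
      ofShard P.dest p = tableTxs (e.seen n t)

/-- The planning transaction is committed in the source shard. -/
def Triggered : Prop := ∃ t, Tx.plan ∈ e.committed P.source t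

/-- The migration terminates: from some time on, the control transactions are committed in both
shards, every honest source node has given up the table, and every honest destination node has
taken it over. -/
def Terminates : Prop :=
  ∃ t₀, ∀ t ≥ t₀,
    (∃ b m, Tx.initCtrl b m ∈ e.committed P.source t ∧ Tx.initCtrl b m ∈ e.committed P.dest t) ∧
    (Tx.dualCtrl ∈ e.committed P.source t ∧ Tx.dualCtrl ∈ e.committed P.dest t) ∧
    (∃ N, Tx.totalCtrl N ∈ e.committed P.source t) ∧
    (∀ n, e.Honest n → P.shardOf n = P.source → e.sourceMode n t (e.seen n t) = .ended) ∧
    (∀ n, e.Honest n → P.shardOf n = P.dest → ∃ T, e.Serves H n t (e.seen n t) T)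

/-- The migration is secure: safety, that is, serializable isolation and durability, and liveness. -/
def SecureMigration : Prop :=
  (∃ ord, e.SerializableIsolation H ord ∧ e.Durability H ord) ∧ (e.Triggered → e.Terminates H)

end Execution

end GriDB

namespace GriDB

variable {P : Setting.{u}}

/-! ## Merkle proofs -/

/-! The serial order is the table transactions of the source chain followed by those of the
destination chain. Safety rests on one observation: a block is committed only if some honest node
checked it on top of exactly the chain that precedes it (`exists_vote`). The source chain therefore
obeys rules that refer to the chain alone (`SourceChain`), and these fix its shape. Its data
statements are those up to the checkpoint followed by the numbered ones of the dual mode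
(`init_spec`), and after the second control transaction no table transaction follows
(`tableTxs_frozen`), so the recorded total is final (`total_spec`).

Without collisions, an accepted copy is the checkpoint table and an accepted Merkle proof shows
membership in the source chain (`merkle_sound`). Copy, total and updates thus rebuild the final
source table, and a node that has taken over works on the source chain followed by its own chain
(`serves_spec`). Since the destination commits table transactions only when the source part is
already final, the concatenation grows only at its end.

For liveness, the three control transactions are obtained one after the other, each by
contradiction: if it is never committed, the conditions under which honest nodes accept the proposed
one eventually hold forever, so consensus must commit it. Repeated requests over fair links supply
the off-chain data. -/

theorem climb_concat (H : Hash P) (d : P.Digest) (path : MerklePath P) (s : Bool × P.Digest) :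
    climb H d (path ++ [s]) = H (stepInput (climb H d path) s) := by
  induction path generalizing d with
  | nil => rfl
  | cons a l ih => simpa [climb] using ih _

theorem climbInputs_concat (H : Hash P) (d : P.Digest) (path : MerklePath P)
    (s : Bool × P.Digest) :
    climbInputs H d (path ++ [s]) = climbInputs H d path ∪ {stepInput (climb H d path) s} := by
  induction path generalizing d with
  | nil => simp [climb, climbInputs]
  | cons a l ih => simp [climb, climbInputs, ih]

/-- Compare the two hash computations from the root downwards. Injectivity turns equal digests into
equal inputs; domain separation then forces an inner node to meet a proof step and a leaf to meet
the leaf. Paths run from leaf to root, so each level removes the last step. -/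
theorem merkle_sound {H : Hash P} {S : Set (HashInput P)} (hS : Set.InjOn H S) {x : Tx P}
    (B : Block P) (path : MerklePath P) (hB : merkleInputs H B ⊆ S)
    (hp : proofInputs H x path ⊆ S) (h : merkleRoot H B = proofRoot H x path) : x ∈ B := by
  have leaf_mem : HashInput.leaf x ∈ S := hp (by simp [proofInputs])
  induction B using merkleRoot.induct generalizing path with
  | case1 =>
    have he : (HashInput.empty : HashInput P) ∈ S := hB (by simp [merkleInputs])
    rcases List.eq_nil_or_concat path with rfl | ⟨p, s, rfl⟩
    · have := hS he leaf_mem (by simpa [merkleRoot, proofRoot, climb] using h)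
      simp at this
    · have hs : stepInput (climb H (H (.leaf x)) p) s ∈ S :=
        hp (by simp [proofInputs, climbInputs_concat])
      have := hS he hs (by simpa [merkleRoot, proofRoot, climb_concat] using h)
      unfold stepInput at this
      split at this <;> simp at this
  | case2 y =>
    have he : (HashInput.leaf y : HashInput P) ∈ S := hB (by simp [merkleInputs])
    rcases List.eq_nil_or_concat path with rfl | ⟨p, s, rfl⟩
    · have := hS he leaf_mem (by simpa [merkleRoot, proofRoot, climb] using h)
      simp_all
    · have hs : stepInput (climb H (H (.leaf x)) p) s ∈ S :=
        hp (by simp [proofInputs, climbInputs_concat])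
      have := hS he hs (by simpa [merkleRoot, proofRoot, climb_concat] using h)
      unfold stepInput at this
      split at this <;> simp at this
  | case3 a b l ih1 ih2 =>
    rw [merkleInputs] at hB
    rw [merkleRoot] at h
    have he := hB (Or.inl rfl)
    rcases List.eq_nil_or_concat path with rfl | ⟨p, s, rfl⟩
    · have := hS he leaf_mem (by simpa [proofRoot, climb] using h)
      simp at this
    · have hs : stepInput (climb H (H (.leaf x)) p) s ∈ S :=
        hp (by simp [proofInputs, climbInputs_concat])
      have heq := hS he hs (by simpa [proofRoot, climb_concat] using h)
      have hp' : proofInputs H x p ⊆ S := fun z hz => hp (by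
        rcases hz with hz | hz
        · exact Or.inl hz
        · exact Or.inr (by rw [List.concat_eq_append, climbInputs_concat]; exact Or.inl hz))
      unfold stepInput at heq
      split at heq
      · exact List.mem_of_mem_drop
          (ih2 p (fun z hz => hB (Or.inr (Or.inr hz))) hp' (HashInput.node.inj heq).2)
      · exact List.mem_of_mem_take
          (ih1 p (fun z hz => hB (Or.inr (Or.inl hz))) hp' (HashInput.node.inj heq).1)

theorem merkle_complete (H : Hash P) (B : Block P) (i : ℕ) (x : Tx P) (h : B[i]? = some x) :
    proofRoot H x (merklePath H B i) = merkleRoot H B := by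
  induction B using merkleRoot.induct generalizing i with
  | case1 => simp at h
  | case2 y =>
    have : y = x := by
      rcases i with _ | i <;> simp at h
      exact h
    simp [proofRoot, merklePath, merkleRoot, climb, this]
  | case3 a b l ih1 ih2 =>
    rw [merklePath, merkleRoot]
    split
    · rename_i hi
      have := ih1 i (by rw [List.getElem?_take_of_lt hi]; exact h)
      rw [proofRoot] at this ⊢
      rw [climb_concat, this]
      simp [stepInput]
    · rename_i hi
      have := ih2 (i - (l.length + 2) / 2) (by
        rw [List.getElem?_drop, Nat.add_sub_cancel' (not_lt.1 hi)]; exact h)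
      rw [proofRoot] at this ⊢
      rw [climb_concat, this]
      simp [stepInput]

/-! ## Lists of transactions -/

/-- Votes concern whole blocks, the invariants single transactions; this locates a transaction
inside its block. -/
theorem exists_block_of_concat_prefix_flatten {α : Type*} {L : List (List α)} {p : List α} {x : α}
    (h : p ++ [x] <+: L.flatten) :
    ∃ c pre post, c ++ [pre ++ x :: post] <+: L ∧ p = c.flatten ++ pre := by
  induction L generalizing p with
  | nil => simp at h
  | cons B L ih =>
    obtain ⟨q, hq⟩ := h
    rw [List.flatten_cons, List.append_assoc, List.append_eq_append_iff] at hq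
    rcases hq with ⟨a, rfl, ha⟩ | ⟨a, rfl, ha⟩
    · rcases a with _ | ⟨y, a⟩
      · obtain ⟨c, pre, post, hc, h2⟩ := ih (p := []) ⟨q, by simpa using ha⟩
        refine ⟨p :: c, pre, post, by simpa using hc, ?_⟩
        simpa using h2
      · simp only [List.cons_append, List.cons.injEq] at ha
        exact ⟨[], p, a, by simp [ha.1], by simp⟩
    · obtain ⟨c, pre, post, hc, h2⟩ := ih (p := a) ⟨q, by rw [ha]; simp⟩
      exact ⟨B :: c, pre, post, by simpa using hc, by simp [h2]⟩

theorem flatten_prefix {α : Type*} {L L' : List (List α)} (h : L <+: L') :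
    L.flatten <+: L'.flatten := by
  obtain ⟨q, rfl⟩ := h
  simp

theorem exists_concat_prefix_of_mem {α : Type*} {L : List α} {x : α} (h : x ∈ L) :
    ∃ p, p ++ [x] <+: L := by
  obtain ⟨p, q, rfl⟩ := List.append_of_mem h
  exact ⟨p, q, by simp⟩

theorem exists_prefix_filterMap {α β : Type*} (f : α → Option β) {L : List α} {l : List β}
    (h : l <+: L.filterMap f) : ∃ p, p <+: L ∧ p.filterMap f = l := by
  obtain ⟨q, hq⟩ := h
  obtain ⟨a, b, rfl, ha, -⟩ := List.filterMap_eq_append_iff.1 hq.symm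
  exact ⟨a, List.prefix_append a b, ha⟩

@[simp] theorem ops_append (l l' : List (Tx P)) : ops (l ++ l') = ops l ++ ops l' := by
  simp [ops]

theorem run_append (T : P.Table) (l l' : List P.Op) : run T (l ++ l') = run (run T l) l' := by
  simp [run]

theorem ops_prefix {l l' : List (Tx P)} (h : l <+: l') : ops l <+: ops l' :=
  h.filterMap _

/-- The statements of the data transactions with a sequence number. -/
def dualOps (l : List (Tx P)) : List P.Op :=
  l.filterMap fun
    | .data _ op (some _) => some op
    | _ => none

@[simp] theorem dualOps_append (l l' : List (Tx P)) :
    dualOps (l ++ l') = dualOps l ++ dualOps l' := by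
  simp [dualOps]

theorem dualCount_eq (l : List (Tx P)) : dualCount l = (dualOps l).length := by
  induction l with
  | nil => rfl
  | cons x l ih =>
    simp only [dualCount, dualOps] at ih ⊢
    cases x with
    | data s op seq => cases seq <;> simp [Tx.seq?, List.filterMap_cons, ih]
    | _ => simp [Tx.seq?, List.filterMap_cons, ih]

@[simp] theorem tableTxs_append (l l' : List (Tx P)) :
    Execution.tableTxs (l ++ l') = Execution.tableTxs l ++ Execution.tableTxs l' := by
  simp [Execution.tableTxs]

@[simp] theorem ofShard_append (s : P.Shard) (l l' : List (Tx P)) :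
    Execution.ofShard s (l ++ l') = Execution.ofShard s l ++ Execution.ofShard s l' := by
  simp [Execution.ofShard]

theorem tableTxs_prefix {l l' : List (Tx P)} (h : l <+: l') :
    Execution.tableTxs l <+: Execution.tableTxs l' := by
  obtain ⟨q, rfl⟩ := h
  simp

theorem mem_tableTxs {l : List (Tx P)} {x : Tx P} :
    x ∈ Execution.tableTxs l ↔ x ∈ l ∧ x.IsTableTx := by
  simp [Execution.tableTxs]

theorem ops_tableTxs (l : List (Tx P)) : ops (Execution.tableTxs l) = ops l := by
  induction l with
  | nil => rfl
  | cons x l ih =>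
    rw [← List.singleton_append, tableTxs_append, ops_append, ops_append, ih]
    congr 1
    cases x <;> simp [Execution.tableTxs, ops, Tx.op?, Tx.IsTableTx, Tx.IsTableTxOf]

theorem tableAfter_tableTxs (l : List (Tx P)) :
    tableAfter (Execution.tableTxs l) = tableAfter l := by
  simp [tableAfter, ops_tableTxs]

theorem ofShard_tableTxs_of_forall {s : P.Shard} {l : List (Tx P)}
    (h : ∀ x ∈ l, x.IsTableTx → x.IsTableTxOf s) :
    Execution.ofShard s (Execution.tableTxs l) = Execution.tableTxs l := by
  classical
  rw [Execution.ofShard, List.filter_eq_self]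
  intro x hx
  rw [mem_tableTxs] at hx
  simpa using h x hx.1 hx.2

theorem Tx.IsTableTxOf.unique {x : Tx P} {s s' : P.Shard} (h : x.IsTableTxOf s)
    (h' : x.IsTableTxOf s') : s = s' := by
  cases x <;> simp_all [Tx.IsTableTxOf]

theorem ofShard_tableTxs_of_ne {s s' : P.Shard} (hs : s ≠ s') {l : List (Tx P)}
    (h : ∀ x ∈ l, x.IsTableTx → x.IsTableTxOf s') :
    Execution.ofShard s (Execution.tableTxs l) = [] := by
  classical
  rw [Execution.ofShard, List.filter_eq_nil_iff]
  intro x hx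
  rw [mem_tableTxs] at hx
  simpa using fun h' => hs (Tx.IsTableTxOf.unique h' (h x hx.1 hx.2))

/-! ## The source chain -/

/-- The list contains the control transaction that ends the init mode. -/
def HasInit (p : List (Tx P)) : Prop := ∃ b m, Tx.initCtrl b m ∈ p

/-- What a vote of an honest source node guarantees about a transaction `x` after the transactions
`p` of the source chain; `c` are the blocks of that chain. -/
def SourceAdmits (H : Hash P) (c : List (Block P)) (p : List (Tx P)) : Tx P → Prop
  | .data s _ seq => s = P.source ∧ Tx.dualCtrl ∉ p ∧
      ((¬HasInit p ∧ seq = none) ∨ (HasInit p ∧ seq = some (dualCount p + 1)))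
  | .query s q r => s = P.source ∧ Tx.dualCtrl ∉ p ∧ r = P.eval q (tableAfter p)
  | .initCtrl b m => ¬HasInit p ∧ ∃ c', c' <+: c ∧ c'.length = b ∧
      m = H (.table (tableAfter c'.flatten)) ∧ ops p = ops c'.flatten
  | .dualCtrl => HasInit p
  | .totalCtrl N => Tx.dualCtrl ∈ p ∧ (∀ N', Tx.totalCtrl N' ∉ p) ∧ N = dualCount p
  | _ => True

/-- All transactions of the list were admitted by the source. -/
def SourceChain (H : Hash P) (c : List (Block P)) (L : List (Tx P)) : Prop :=
  ∀ p x, p ++ [x] <+: L → SourceAdmits H c p x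

namespace SourceChain

variable {H : Hash P} {c : List (Block P)} {L : List (Tx P)}

theorem of_prefix (h : SourceChain H c L) {L' : List (Tx P)} (hL : L' <+: L) :
    SourceChain H c L' := fun p x hp => h p x (hp.trans hL)

theorem init_of_concat {x : Tx P} (h : SourceChain H c (L ++ [x])) : SourceChain H c L :=
  h.of_prefix (List.prefix_append _ _)

theorem last {x : Tx P} (h : SourceChain H c (L ++ [x])) : SourceAdmits H c L x :=
  h L x (List.prefix_rfl)

theorem tableTx_source (h : SourceChain H c L) {x : Tx P} (hx : x ∈ L) (ht : x.IsTableTx) :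
    x.IsTableTxOf P.source := by
  obtain ⟨p, hp⟩ := exists_concat_prefix_of_mem hx
  have := h p x hp
  obtain ⟨s, hs⟩ := ht
  cases x <;> simp_all [Tx.IsTableTxOf, SourceAdmits]

theorem dualOps_eq_nil (h : SourceChain H c L) (hL : ¬HasInit L) : dualOps L = [] := by
  induction L using List.reverseRecOn with
  | nil => rfl
  | append_singleton l x ih =>
    have hl : ¬HasInit l := fun ⟨b, m, hb⟩ => hL ⟨b, m, by simp [hb]⟩
    have hx := h.last
    rw [dualOps_append, ih h.init_of_concat hl]
    cases x with
    | data s op seq =>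
      have : seq = none := by
        rcases hx.2.2 with h | h
        · exact h.2
        · exact absurd h.1 hl
      simp [dualOps, this]
    | _ => simp [dualOps]

/-- A number is admitted only if it is one more than the count of numbered predecessors, so it
encodes a position (from 1) and determines the statement. -/
theorem dualOps_getElem? (h : SourceChain H c L) {s : P.Shard} {op : P.Op} {k : ℕ}
    (hx : Tx.data s op (some k) ∈ L) : ∃ i, k = i + 1 ∧ (dualOps L)[i]? = some op := by
  obtain ⟨p, q, rfl⟩ := List.append_of_mem hx
  have := h p _ ⟨q, by rw [List.append_assoc]; rfl⟩
  rcases this.2.2 with h | h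
  · simp at h
  · refine ⟨(dualOps p).length, by simpa [dualCount_eq] using h.2, ?_⟩
    rw [dualOps_append, List.getElem?_append_right le_rfl]
    simp [dualOps]

theorem mem_of_dualOps_getElem? (h : SourceChain H c L) {op : P.Op} {i : ℕ}
    (hi : (dualOps L)[i]? = some op) : Tx.data P.source op (some (i + 1)) ∈ L := by
  have hop : op ∈ dualOps L := List.mem_of_getElem? hi
  induction L using List.reverseRecOn with
  | nil => simp [dualOps] at hi
  | append_singleton l x ih =>
    by_cases hl : i < (dualOps l).length
    · rw [dualOps_append, List.getElem?_append_left hl] at hi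
      exact List.mem_append_left _ (ih h.init_of_concat hi (List.mem_of_getElem? hi))
    · rw [dualOps_append, List.getElem?_append_right (not_lt.1 hl)] at hi
      have hx := h.last
      cases x with
      | data s op' seq =>
        cases seq with
        | none => simp [dualOps] at hi
        | some k =>
          have h2 := hx.2.2
          simp only [reduceCtorEq, and_false, false_or, dualCount_eq, Option.some.injEq] at h2
          have hs : dualOps [Tx.data s op' (some k)] = [op'] := rfl
          rw [hs, List.getElem?_singleton] at hi
          split at hi
          · have hi' : i = (dualOps l).length := by omega
            simp [hi', h2.2, hx.1, Option.some.inj hi]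
          · simp at hi
      | _ => simp [dualOps] at hi

/-- When the control transaction is admitted, no data statement has followed the checkpoint and
nothing is numbered yet; from then on every data transaction is numbered. -/
theorem init_spec (h : SourceChain H c L) {b : ℕ} {m : P.Digest} (hb : Tx.initCtrl b m ∈ L) :
    ∃ c', c' <+: c ∧ c'.length = b ∧ m = H (.table (tableAfter c'.flatten)) ∧
      ops L = ops c'.flatten ++ dualOps L := by
  induction L using List.reverseRecOn with
  | nil => simp at hb
  | append_singleton l x ih =>
    by_cases hl : Tx.initCtrl b m ∈ l
    · obtain ⟨c', h1, h2, h3, h4⟩ := ih h.init_of_concat hl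
      refine ⟨c', h1, h2, h3, ?_⟩
      rw [ops_append, h4, dualOps_append, List.append_assoc]
      congr 2
      have hx := h.last
      cases x with
      | data s op seq =>
        rcases hx.2.2 with h | h
        · exact absurd ⟨b, m, hl⟩ h.1
        · simp [ops, dualOps, Tx.op?, h.2]
      | _ => simp [ops, dualOps, Tx.op?]
    · have hxe : x = Tx.initCtrl b m := by simpa [hl, eq_comm] using hb
      subst hxe
      obtain ⟨hn, c', h1, h2, h3, h4⟩ := h.last
      refine ⟨c', h1, h2, h3, ?_⟩
      rw [ops_append, dualOps_append, h4, h.init_of_concat.dualOps_eq_nil hn]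
      rfl

theorem hasInit_of_dualCtrl (h : SourceChain H c L) (hd : Tx.dualCtrl ∈ L) : HasInit L := by
  obtain ⟨p, hp⟩ := exists_concat_prefix_of_mem hd
  obtain ⟨b, m, hb⟩ := h p _ hp
  exact ⟨b, m, hp.subset (by simp [hb])⟩

/-- Data and query transactions are admitted only while the second control transaction is absent. -/
theorem tableTxs_frozen (h : SourceChain H c L) {p : List (Tx P)} (hp : p <+: L)
    (hd : Tx.dualCtrl ∈ p) : Execution.tableTxs L = Execution.tableTxs p := by
  induction L using List.reverseRecOn with
  | nil => rw [List.prefix_nil.1 hp]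
  | append_singleton l x ih =>
    rcases List.prefix_concat_iff.1 hp with rfl | hp
    · rfl
    · rw [tableTxs_append, ih h.init_of_concat hp]
      have hx := h.last
      have hd' := hp.subset hd
      have : ¬ x.IsTableTx := by
        rintro ⟨s, hs⟩
        cases x <;> simp_all [SourceAdmits, Tx.IsTableTxOf]
      simp [Execution.tableTxs, this]

theorem dualOps_tableTxs (l : List (Tx P)) : dualOps (Execution.tableTxs l) = dualOps l := by
  induction l with
  | nil => rfl
  | cons x l ih =>
    rw [← List.singleton_append, tableTxs_append, dualOps_append, dualOps_append, ih]
    congr 1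
    cases x <;> simp [Execution.tableTxs, dualOps, Tx.IsTableTx, Tx.IsTableTxOf]

theorem dualOps_frozen (h : SourceChain H c L) {p : List (Tx P)} (hp : p <+: L)
    (hd : Tx.dualCtrl ∈ p) : dualOps L = dualOps p := by
  rw [← dualOps_tableTxs, h.tableTxs_frozen hp hd, dualOps_tableTxs]

/-- The total was correct for the prefix before it; that prefix contains `dualCtrl`, after which the
count no longer changes. -/
theorem total_spec (h : SourceChain H c L) {N : ℕ} (hN : Tx.totalCtrl N ∈ L) :
    Tx.dualCtrl ∈ L ∧ N = (dualOps L).length := by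
  obtain ⟨p, hp⟩ := exists_concat_prefix_of_mem hN
  obtain ⟨hd, -, hN⟩ := h p _ hp
  have hp' := (List.prefix_append p _).trans hp
  exact ⟨hp'.subset hd, by rw [hN, dualCount_eq, h.dualOps_frozen hp' hd]⟩

end SourceChain

/-! ## What the votes of honest nodes guarantee -/

namespace Execution

/-- The assumptions behind safety: the consensus is safe, honest nodes vote as the protocol says,
and there is no hash collision. -/
structure SafeRun (H : Hash P) (e : Execution P) : Prop where
  consensus : e.ConsensusSafety H
  votes : ∀ n, e.Honest n → ∀ t B, e.endorses n t B ↔ e.BlockOK H n t B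
  noCollision : e.NoCollision H

variable {H : Hash P} {e : Execution P} {n : P.Node} {t t' : ℕ}

theorem sourceMode_ended_iff {p : List (Tx P)} :
    e.sourceMode n t p = .ended ↔ Tx.dualCtrl ∈ p := by
  unfold sourceMode
  split_ifs <;> simp_all

theorem sourceMode_dual_iff {p : List (Tx P)} :
    e.sourceMode n t p = .dual ↔
      Tx.dualCtrl ∉ p ∧ ∃ b m, Tx.initCtrl b m ∈ p ∧ e.confirmed n t (.initCtrl b m) := by
  unfold sourceMode
  split_ifs with h1 h2 h3 h4
  · simp [h1]
  · simp only [h1, not_false_eq_true, true_and, true_iff]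
    exact h3
  · simp only [h1, not_false_eq_true, true_and, false_iff]
    exact h3
  all_goals
    simp only [false_iff]
    rintro ⟨-, b, m, hb, -⟩
    exact h2 ⟨b, m, hb⟩

theorem sourceMode_normal_iff {p : List (Tx P)} :
    e.sourceMode n t p = .normal ↔ Tx.dualCtrl ∉ p ∧ ¬HasInit p ∧ ¬e.started n t := by
  unfold sourceMode HasInit
  split_ifs <;> simp_all

theorem sourceMode_init_of_started {p : List (Tx P)} (hd : Tx.dualCtrl ∉ p) (hi : ¬HasInit p)
    (hs : e.started n t) : e.sourceMode n t p = .init := by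
  unfold sourceMode
  unfold HasInit at hi
  rw [if_neg hd, if_neg hi, if_pos hs]

namespace SafeRun

theorem committed_prefix (h : e.SafeRun H) (s : P.Shard) (ht : t ≤ t') :
    e.committed s t <+: e.committed s t' := flatten_prefix (h.consensus.ledger_mono s t t' ht)

theorem seen_prefix (h : e.SafeRun H) (hn : e.Honest n) (t : ℕ) :
    e.seen n t <+: e.committed (P.shardOf n) t := flatten_prefix (h.consensus.view_le n hn t)

/-- A strict majority of the honest nodes is nonempty, so at least one honest node ran the
protocol's check with the preceding blocks as its view. -/
theorem exists_vote (h : e.SafeRun H) {s : P.Shard} {p : List (Tx P)} {x : Tx P}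
    (hp : p ++ [x] <+: e.committed s t) :
    ∃ n t' pre post, e.Honest n ∧ P.shardOf n = s ∧ t' ≤ t ∧ p = e.seen n t' ++ pre ∧
      e.view n t' ++ [pre ++ x :: post] <+: e.ledger s t ∧
      (s = P.source → e.SourceOK H n t' pre x) ∧ (s = P.dest → e.DestOK H n t' pre x) ∧
      (s ≠ P.source → s ≠ P.dest → e.BystanderOK n t' pre x) := by
  obtain ⟨c, pre, post, hc, rfl⟩ := exists_block_of_concat_prefix_flatten hp
  have hlt := h.consensus.endorsed s t c _ hc
  obtain ⟨n, ⟨hns, hn⟩, t', ht', hv, hB⟩ := Set.nonempty_of_ncard_ne_zero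
    (s := {n ∈ e.honestIn s | ∃ t' ≤ t, e.view n t' = c ∧ e.endorses n t' (pre ++ x :: post)})
    (by omega)
  have := (h.votes n hn t' _).1 hB pre x post rfl
  rw [hns] at this
  exact ⟨n, t', pre, post, hn, hns, ht', by rw [← hv]; rfl, by rwa [hv], this⟩

theorem exists_honest_of_mem (h : e.SafeRun H) {s : P.Shard} {x : Tx P}
    (hx : x ∈ e.committed s t) : ∃ n, e.Honest n ∧ P.shardOf n = s := by
  obtain ⟨p, hp⟩ := exists_concat_prefix_of_mem hx
  obtain ⟨n, t', pre, post, hn, hs, -⟩ := h.exists_vote hp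
  exact ⟨n, hn, hs⟩

/-- The voter's local knowledge (`started`, `confirmed`) is discarded; what remains of the mode can
be read off the chain. -/
theorem sourceChain (h : e.SafeRun H) (t : ℕ) :
    SourceChain H (e.ledger P.source t) (e.committed P.source t) := by
  intro p x hp
  obtain ⟨n, t', pre, post, hn, hs, ht', rfl, hv, hok, -, -⟩ := h.exists_vote hp
  have hok := hok rfl
  cases x with
  | data s op seq =>
    obtain ⟨h1, -, h3⟩ := hok
    refine ⟨h1, ?_⟩
    rcases h3 with ⟨h3, h4⟩ | ⟨h3, h4⟩
    · rw [sourceMode_normal_iff] at h3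
      exact ⟨h3.1, Or.inl ⟨h3.2.1, h4⟩⟩
    · rw [sourceMode_dual_iff] at h3
      obtain ⟨h3, b, m, hb, -⟩ := h3
      exact ⟨h3, Or.inr ⟨⟨b, m, hb⟩, h4⟩⟩
  | query s q r =>
    obtain ⟨h1, -, h3, h4⟩ := hok
    rw [Ne, sourceMode_ended_iff] at h3
    exact ⟨h1, h3, h4⟩
  | plan => trivial
  | initCtrl b m =>
    obtain ⟨-, h2, h3, h4, h5⟩ := hok
    refine ⟨fun ⟨b', m', hb⟩ => h2 b' m' hb, (e.view n t').take b, ?_, ?_, h4, ?_⟩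
    · exact (List.take_prefix _ _).trans ((List.prefix_append _ _).trans hv)
    · simpa using h3
    -- Cut the voter's view at the checkpoint; the part behind it, with `pre`, holds no data
    -- statement.
    · conv_lhs => rw [ChainRun.seen, ← List.take_append_drop b (e.view n t'), List.flatten_append,
        List.append_assoc, ops_append, h5]
      simp
  | dualCtrl =>
    obtain ⟨-, b, m, hb, -⟩ := sourceMode_dual_iff.1 hok
    exact ⟨b, m, hb⟩
  | totalCtrl N =>
    obtain ⟨h1, -, h3, h4⟩ := hok
    exact ⟨sourceMode_ended_iff.1 h1, h3, h4⟩
  | other R a => trivial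

/-- Confirmation puts the control transaction on the source chain, where its digest is that of the
checkpoint table; no collision means that the copy is this table. -/
theorem table_committed_of_holdsCopy (h : e.SafeRun H) (hn : e.Honest n) {p : List (Tx P)}
    {T : P.Table} (ha : e.CrossShardAtomicity) (hT : e.HoldsCopy H n t p T) :
    ∃ l, ops (e.committed P.source t) = l ++ dualOps (e.committed P.source t) ∧
      T = run P.genesis l := by
  obtain ⟨b, m, -, hc, hr, hm⟩ := hT
  have hb := ha.confirmed_sound n hn t _ hc P.source (by simp [Tx.related])
  obtain ⟨c, h1, h2, h3, h4⟩ := (h.sourceChain t).init_spec hb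
  refine ⟨_, h4, ?_⟩
  have hT : HashInput.table T ∈ e.hashed H :=
    Or.inr (Or.inr (Or.inl ⟨n, t, T, hn, hr, rfl⟩))
  have hc : HashInput.table (tableAfter c.flatten) ∈ e.hashed H :=
    Or.inr (Or.inl ⟨t, b, by rw [← h2, ← List.prefix_iff_eq_take.1 h1]⟩)
  exact HashInput.table.inj (h.noCollision hT hc (hm.trans h3))

theorem mem_of_holdsProof (h : e.SafeRun H) (hn : e.Honest n) {x : Tx P}
    (hx : e.HoldsProof H n t x) : x ∈ e.committed P.source t := by
  obtain ⟨j, path, hr, hj⟩ := hx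
  have hj' := (List.prefix_iff_getElem?.1 (h.consensus.headers_le n hn P.source t)) j
    (List.getElem?_eq_some_iff.1 hj).1
  rw [(List.getElem?_eq_some_iff.1 hj).2, List.getElem?_map, Option.map_eq_some_iff] at hj'
  obtain ⟨B, hB, hB'⟩ := hj'
  have hmem := List.mem_of_getElem? hB
  refine List.mem_flatten.2 ⟨B, hmem, merkle_sound h.noCollision B path ?_ ?_ hB'⟩
  · exact fun z hz => Or.inl ⟨t, B, hmem, hz⟩
  · exact fun z hz => Or.inr (Or.inr (Or.inr ⟨n, t, x, j, path, hn, hr, hz⟩))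

theorem holdsUpdates_prefix (h : e.SafeRun H) (hn : e.Honest n) {l : List P.Op}
    (hl : e.HoldsUpdates H n t l) : l <+: dualOps (e.committed P.source t) := by
  rw [List.prefix_iff_getElem?]
  intro i hi
  obtain ⟨j, hj, hop⟩ := (h.sourceChain t).dualOps_getElem?
    (h.mem_of_holdsProof hn (hl i _ (List.getElem?_eq_getElem hi)))
  obtain rfl : i = j := by omega
  exact hop

/-- The proven updates form a prefix of the numbered statements, and the proven total says that the
prefix is everything. -/
theorem serves_spec (h : e.SafeRun H) (hn : e.Honest n) (ha : e.CrossShardAtomicity)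
    {p : List (Tx P)} {T : P.Table} (hT : e.Serves H n t p T) :
    Tx.dualCtrl ∈ e.committed P.source t ∧ T = tableAfter (e.committed P.source t ++ p) := by
  obtain ⟨-, T₀, l, hT₀, hl, hN, rfl⟩ := hT
  obtain ⟨l₀, h1, rfl⟩ := h.table_committed_of_holdsCopy hn ha hT₀
  obtain ⟨hd, hlen⟩ := (h.sourceChain t).total_spec (h.mem_of_holdsProof hn hN)
  refine ⟨hd, ?_⟩
  rw [tableAfter, ops_append, h1, ← (h.holdsUpdates_prefix hn hl).eq_of_length hlen,
    List.append_assoc, run_append P.genesis l₀]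

theorem source_frozen (h : e.SafeRun H) (hd : Tx.dualCtrl ∈ e.committed P.source t)
    (ht : t ≤ t') :
    tableTxs (e.committed P.source t') = tableTxs (e.committed P.source t) :=
  (h.sourceChain t').tableTxs_frozen (h.committed_prefix _ ht) hd

theorem bystander_tableTxs (h : e.SafeRun H) {s : P.Shard} (hs : s ≠ P.source) (hd : s ≠ P.dest)
    {x : Tx P} (hx : x ∈ e.committed s t) : ¬x.IsTableTx := by
  obtain ⟨p, hp⟩ := exists_concat_prefix_of_mem hx
  obtain ⟨n, t', pre, post, -, -, -, -, -, -, -, hok⟩ := h.exists_vote hp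
  have := hok hs hd
  rintro ⟨s, hs⟩
  cases x <;> simp_all [Tx.IsTableTxOf, BystanderOK]

/-- The voter evaluated against the source chain at its own time `t'`; the second control
transaction was already there, so the source's table transactions are the same at `t`. -/
theorem dest_tableTx (h : e.SafeRun H) (ha : e.CrossShardAtomicity) {p : List (Tx P)} {x : Tx P}
    (hp : p ++ [x] <+: e.committed P.dest t) (hx : x.IsTableTx) :
    x.IsTableTxOf P.dest ∧ Tx.dualCtrl ∈ e.committed P.source t ∧
      ∀ s q r, x = .query s q r → r = P.eval q (tableAfter (e.committed P.source t ++ p)) := by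
  obtain ⟨n, t', pre, post, hn, hs, ht', rfl, -, -, hok, -⟩ := h.exists_vote hp
  have hok := hok rfl
  have key : ∀ T, e.Serves H n t' (e.seen n t' ++ pre) T → Tx.dualCtrl ∈ e.committed P.source t ∧
      T = tableAfter (e.committed P.source t ++ (e.seen n t' ++ pre)) := by
    intro T hT
    obtain ⟨hd, rfl⟩ := h.serves_spec hn ha hT
    refine ⟨(h.committed_prefix _ ht').subset hd, ?_⟩
    rw [tableAfter, tableAfter, ops_append, ops_append (e.committed P.source t),
      ← ops_tableTxs (e.committed P.source t), h.source_frozen hd ht', ops_tableTxs]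
  obtain ⟨s, hs⟩ := hx
  cases x with
  | data s op seq =>
    obtain ⟨h1, -, -, T, hT⟩ := hok
    exact ⟨h1, (key T hT).1, by simp⟩
  | query s q r =>
    obtain ⟨h1, -, T, hT, hr⟩ := hok
    refine ⟨h1, (key T hT).1, ?_⟩
    rintro _ _ _ ⟨⟩
    rw [hr, (key T hT).2]
  | _ => exact hs.elim

theorem dest_tableTxOf (h : e.SafeRun H) (ha : e.CrossShardAtomicity) {x : Tx P}
    (hx : x ∈ e.committed P.dest t) (ht : x.IsTableTx) : x.IsTableTxOf P.dest := by
  obtain ⟨p, hp⟩ := exists_concat_prefix_of_mem hx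
  exact (h.dest_tableTx ha hp ht).1

end SafeRun

/-! ## Safety -/

/-- The serial order: the transactions of the table in the source chain, then those in the
destination chain. -/
noncomputable def serialOrder (e : Execution P) (t : ℕ) : List (Tx P) :=
  tableTxs (e.committed P.source t) ++ tableTxs (e.committed P.dest t)

namespace SafeRun

theorem serialOrder_mono (h : e.SafeRun H) (ha : e.CrossShardAtomicity) (ht : t ≤ t') :
    e.serialOrder t <+: e.serialOrder t' := by
  unfold serialOrder
  -- Growth of the source part would insert in the middle only if the destination part is nonempty,
  -- and then the source part is frozen.
  by_cases hd : tableTxs (e.committed P.dest t) = []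
  · rw [hd, List.append_nil]
    exact (tableTxs_prefix (h.committed_prefix _ ht)).trans (List.prefix_append _ _)
  · obtain ⟨x, hx⟩ := List.exists_mem_of_ne_nil _ hd
    rw [mem_tableTxs] at hx
    obtain ⟨p, hp⟩ := exists_concat_prefix_of_mem hx.1
    rw [h.source_frozen (h.dest_tableTx ha hp hx.2).2.1 ht, List.prefix_append_right_inj]
    exact tableTxs_prefix (h.committed_prefix _ ht)

theorem ofShard_source (h : e.SafeRun H) (t : ℕ) :
    ofShard P.source (tableTxs (e.committed P.source t)) = tableTxs (e.committed P.source t) :=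
  ofShard_tableTxs_of_forall fun _ hx => (h.sourceChain t).tableTx_source hx

theorem ofShard_serialOrder (h : e.SafeRun H) (ha : e.CrossShardAtomicity) (s : P.Shard) (t : ℕ) :
    ofShard s (e.serialOrder t) = tableTxs (e.committed s t) := by
  have hsrc := fun x (hx : x ∈ e.committed P.source t) => (h.sourceChain t).tableTx_source hx
  have hdst := fun x (hx : x ∈ e.committed P.dest t) => h.dest_tableTxOf ha hx
  rw [serialOrder, ofShard_append]
  by_cases hs : s = P.source
  · subst hs
    rw [h.ofShard_source, ofShard_tableTxs_of_ne P.source_ne_dest hdst, List.append_nil]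
  · rw [ofShard_tableTxs_of_ne hs hsrc, List.nil_append]
    by_cases hd : s = P.dest
    · subst hd
      exact ofShard_tableTxs_of_forall hdst
    · rw [ofShard_tableTxs_of_ne hd hdst, eq_comm, List.eq_nil_iff_forall_not_mem]
      intro x hx
      rw [mem_tableTxs] at hx
      exact h.bystander_tableTxs hs hd hx.1 hx.2

theorem serialOrder_legal (h : e.SafeRun H) (ha : e.CrossShardAtomicity) {p l : List (Tx P)}
    {s : P.Shard} {q : P.Query} {r : P.Res} (hp : e.serialOrder t = p ++ Tx.query s q r :: l) :
    r = P.eval q (tableAfter p) := by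
  -- Lifts a position in the filtered list to one in the chain, where the vote invariants apply.
  have key : ∀ (L a b : List (Tx P)), tableTxs L = a ++ Tx.query s q r :: b →
      ∃ p', p' ++ [Tx.query s q r] <+: L ∧ tableTxs p' = a := by
    intro L a b hab
    obtain ⟨u, v, rfl, hu, hv⟩ := List.filter_eq_append_iff.1 hab
    obtain ⟨v₁, v₂, rfl, hv₁, -, -⟩ := List.filter_eq_cons_iff.1 hv
    refine ⟨u ++ v₁, ⟨v₂, by simp⟩, ?_⟩
    rw [tableTxs_append]
    have : tableTxs v₁ = [] := by
      rw [tableTxs, List.filter_eq_nil_iff]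
      exact hv₁
    rw [this, List.append_nil]
    exact hu
  rw [serialOrder, List.append_eq_append_iff] at hp
  rcases hp with ⟨a, rfl, ha'⟩ | ⟨a, ha', hb⟩
  · obtain ⟨p', hp', rfl⟩ := key _ _ _ ha'
    have := (h.dest_tableTx ha hp' ⟨s, rfl⟩).2.2 s q r rfl
    rw [this]
    simp [tableAfter, ops_tableTxs]
  · rcases a with _ | ⟨y, a⟩
    -- Boundary case: the query is the first table transaction of the destination, and `p` is the
    -- whole source part.
    · obtain ⟨p', hp', hp''⟩ := key _ [] l hb.symm
      have := (h.dest_tableTx ha hp' ⟨s, rfl⟩).2.2 s q r rfl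
      rw [List.append_nil] at ha'
      rw [this, ← ha', tableAfter, tableAfter, ops_append, ops_tableTxs, ← ops_tableTxs p', hp'']
      simp [ops]
    · obtain ⟨rfl, -⟩ : Tx.query s q r = y ∧ _ := by simpa using hb
      obtain ⟨p', hp', rfl⟩ := key _ _ _ ha'
      rw [tableAfter_tableTxs]
      exact ((h.sourceChain t) p' _ hp').2.2

theorem serves_prefix (h : e.SafeRun H) (ha : e.CrossShardAtomicity) (hn : e.Honest n)
    (hd : P.shardOf n = P.dest) {T : P.Table} (hT : e.Serves H n t (e.seen n t) T) :
    tableTxs (e.committed P.source t) ++ tableTxs (e.seen n t) <+: e.serialOrder t ∧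
      T = tableAfter (tableTxs (e.committed P.source t) ++ tableTxs (e.seen n t)) := by
  refine ⟨?_, ?_⟩
  · rw [serialOrder, List.prefix_append_right_inj, ← hd]
    exact tableTxs_prefix (h.seen_prefix hn t)
  · rw [(h.serves_spec hn ha hT).2, ← tableTxs_append, tableAfter_tableTxs]

theorem replica_prefix (h : e.SafeRun H) (ha : e.CrossShardAtomicity) (hn : e.Honest n)
    {T : P.Table} (hT : e.Replica H n t T) : ∃ p, p <+: e.serialOrder t ∧ T = tableAfter p := by
  rcases hT with ⟨hs, rfl⟩ | ⟨hd, ⟨T₀, l, hT₀, hl, rfl⟩ | hT⟩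
  · refine ⟨tableTxs (e.seen n t), ?_, (tableAfter_tableTxs _).symm⟩
    have := tableTxs_prefix (h.seen_prefix hn t)
    rw [hs] at this
    exact this.trans (List.prefix_append _ _)
  · obtain ⟨l₀, h1, rfl⟩ := h.table_committed_of_holdsCopy hn ha hT₀
    -- Before takeover only some updates may be present; copy and updates still give an initial
    -- segment of the source's statements, which lifts to one of the transactions.
    have hp : l₀ ++ l <+: (tableTxs (e.committed P.source t)).filterMap Tx.op? := by
      change _ <+: ops _
      rw [ops_tableTxs, h1, List.prefix_append_right_inj]
      exact h.holdsUpdates_prefix hn hl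
    obtain ⟨p, hp, hp'⟩ := exists_prefix_filterMap _ hp
    refine ⟨p, hp.trans (List.prefix_append _ _), ?_⟩
    rw [tableAfter, ops, hp', run_append]
  · exact ⟨_, h.serves_prefix ha hn hd hT⟩

theorem serializableIsolation (h : e.SafeRun H) (ha : e.CrossShardAtomicity) :
    e.SerializableIsolation H e.serialOrder where
  mono _ _ := h.serialOrder_mono ha
  only t x hx := by
    rcases List.mem_append.1 hx with hx | hx <;> exact (mem_tableTxs.1 hx).2
  complete := h.ofShard_serialOrder ha
  legal _ _ _ _ _ _ := h.serialOrder_legal ha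
  replicas _ _ _ hn := h.replica_prefix ha hn

theorem durability (h : e.SafeRun H) (ha : e.CrossShardAtomicity) :
    e.Durability H e.serialOrder where
  keeps s _ _ := h.committed_prefix s
  reflects n t T hn hd hT := by
    refine ⟨_, (h.serves_prefix ha hn hd hT).1, (h.serves_prefix ha hn hd hT).2, fun t' => ?_, ?_⟩
    · have hseen : ∀ x ∈ e.seen n t, x.IsTableTx → x.IsTableTxOf P.dest := fun x hx =>
        h.dest_tableTxOf ha (hd ▸ (h.seen_prefix hn t).subset hx)
      rw [ofShard_append, h.ofShard_source, ofShard_tableTxs_of_ne P.source_ne_dest hseen,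
        List.append_nil]
      rcases le_total t t' with ht | ht
      · rw [h.source_frozen (h.serves_spec hn ha hT).1 ht]
      · exact tableTxs_prefix (h.committed_prefix _ ht)
    · have hseen : ∀ x ∈ e.seen n t, x.IsTableTx → x.IsTableTxOf P.dest := fun x hx =>
        h.dest_tableTxOf ha (hd ▸ (h.seen_prefix hn t).subset hx)
      rw [ofShard_append, ofShard_tableTxs_of_forall hseen,
        ofShard_tableTxs_of_ne P.source_ne_dest.symm
          fun x hx => (h.sourceChain t).tableTx_source hx, List.nil_append]

end SafeRun

/-! ## Liveness -/

/-- The assumptions of the theorem about one execution. -/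
structure LiveRun (H : Hash P) (e : Execution P) : Prop extends SafeRun H e where
  live : e.ConsensusLiveness H
  atomicity : e.CrossShardAtomicity
  protocol : e.FollowsProtocol H
  links : e.FairLinks

theorem Received.mono {msg : Msg P} (h : e.Received n t msg) (ht : t ≤ t') :
    e.Received n t' msg := by
  obtain ⟨t₁, h1, h2⟩ := h
  exact ⟨t₁, h1.trans ht, h2⟩

/-- The hypothesis speaks of positions rather than membership, because the same transaction may
occur repeatedly. -/
theorem ops_eq_of_forall {l l' : List (Tx P)} (hl : l <+: l')
    (h : ∀ p x, p ++ [x] <+: l' → x.op? ≠ none → p ++ [x] <+: l) : ops l' = ops l := by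
  obtain ⟨q, rfl⟩ := hl
  suffices ops q = [] by rw [ops_append, this, List.append_nil]
  rw [ops, List.filterMap_eq_nil_iff]
  intro x hx
  by_contra hop
  obtain ⟨a, b, rfl⟩ := List.append_of_mem hx
  have := (h (l ++ a) x ⟨b, by simp⟩ hop).length_le
  simp only [List.length_append, List.length_singleton] at this
  omega

theorem exists_block_of_mem_committed {s : P.Shard} {x : Tx P} (hx : x ∈ e.committed s t) :
    ∃ (j : ℕ) (B : Block P) (i : ℕ), (e.ledger s t)[j]? = some B ∧ B[i]? = some x := by
  obtain ⟨B, hB, hxB⟩ := List.mem_flatten.1 hx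
  obtain ⟨j, hj⟩ := List.getElem?_of_mem hB
  obtain ⟨i, hi⟩ := List.getElem?_of_mem hxB
  exact ⟨j, B, i, hj, hi⟩

theorem prefix_getElem? {α : Type*} {l l' : List α} (h : l <+: l') {i : ℕ} {a : α}
    (ha : l[i]? = some a) : l'[i]? = some a := by
  obtain ⟨q, rfl⟩ := h
  rw [List.getElem?_append_left (List.getElem?_eq_some_iff.1 ha).1, ha]

namespace LiveRun

/-! ### Eventual knowledge and commitment -/

theorem eventually_view (h : e.LiveRun H) (hn : e.Honest n) (t : ℕ) :
    ∀ᶠ t' in atTop, e.ledger (P.shardOf n) t <+: e.view n t' := by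
  obtain ⟨t₁, h₁⟩ := h.live.catch_up n hn t
  filter_upwards [eventually_ge_atTop t₁] with t' ht'
  exact h₁.trans (h.consensus.view_mono n hn _ _ ht')

theorem eventually_seen (h : e.LiveRun H) (hn : e.Honest n) {x : Tx P}
    (hx : ∃ t, x ∈ e.committed (P.shardOf n) t) : ∀ᶠ t in atTop, x ∈ e.seen n t := by
  obtain ⟨t, hx⟩ := hx
  filter_upwards [h.eventually_view hn t] with t' ht'
  exact (flatten_prefix ht').subset hx

theorem eventually_confirmed (h : e.LiveRun H) (hn : e.Honest n) {x : Tx P}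
    (hx : ∃ t, x ∈ e.committed (P.shardOf n) t) (hr : P.shardOf n ∈ x.related) :
    ∀ᶠ t in atTop, e.confirmed n t x := by
  obtain ⟨t, hx⟩ := hx
  obtain ⟨t₁, h₁⟩ := h.atomicity.confirmed_live n hn x hr (h.atomicity.atomic x _ t hr hx)
  filter_upwards [eventually_ge_atTop t₁] with t' ht'
  exact h.atomicity.confirmed_mono n hn _ _ x ht' h₁

theorem endorses_of_sourceOK (h : e.LiveRun H) (hn : e.Honest n) (hs : P.shardOf n = P.source)
    {x : Tx P} (hx : e.SourceOK H n t [] x) : e.endorses n t [x] := by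
  rw [h.votes n hn]
  intro pre y post hB
  obtain ⟨rfl, rfl, rfl⟩ : pre = [] ∧ x = y ∧ post = [] := by
    rcases pre with _ | ⟨z, pre⟩
    · simpa [eq_comm] using hB
    · simp at hB
  exact ⟨fun _ => hx, fun hd => absurd (hs.symm.trans hd) P.source_ne_dest,
    fun hns => absurd hs hns⟩

theorem endorses_of_destOK (h : e.LiveRun H) (hn : e.Honest n) (hd : P.shardOf n = P.dest)
    {x : Tx P} (hx : e.DestOK H n t [] x) : e.endorses n t [x] := by
  rw [h.votes n hn]
  intro pre y post hB
  obtain ⟨rfl, rfl, rfl⟩ : pre = [] ∧ x = y ∧ post = [] := by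
    rcases pre with _ | ⟨z, pre⟩
    · simpa [eq_comm] using hB
    · simp at hB
  exact ⟨fun hs => absurd (hs.symm.trans hd) P.source_ne_dest, fun _ => hx,
    fun _ hnd => absurd hd hnd⟩

/-- It suffices that each honest node separately accepts from some time on: there are finitely many
nodes, so a common time exists. -/
theorem commits (h : e.LiveRun H) (hn : e.Honest n) {x : Tx P} (hr : P.shardOf n ∈ x.related)
    (hrel : x.related ⊆ {P.source, P.dest}) (hp : e.proposes n t x)
    (hsrc : ∀ n', e.Honest n' → P.shardOf n' = P.source →
      ∀ᶠ t in atTop, x ∉ e.seen n' t → e.SourceOK H n' t [] x)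
    (hdst : P.dest ∈ x.related → ∀ n', e.Honest n' → P.shardOf n' = P.dest →
      ∀ᶠ t in atTop, x ∉ e.seen n' t → e.DestOK H n' t [] x) :
    ∃ t, x ∈ e.committed (P.shardOf n) t := by
  have := P.finiteNode
  refine h.live.commits x n t hn hr hp ?_ _ hr
  rw [← eventually_atTop]
  refine eventually_all.2 fun n' => ?_
  by_cases hn' : e.Honest n' ∧ P.shardOf n' ∈ x.related
  · rcases hrel hn'.2 with hs | hd
    · filter_upwards [hsrc n' hn'.1 hs] with t ht _ _ hx
      exact h.endorses_of_sourceOK hn'.1 hs (ht hx)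
    · rw [Set.mem_singleton_iff] at hd
      filter_upwards [hdst (hd ▸ hn'.2) n' hn'.1 hd] with t ht _ _ hx
      exact h.endorses_of_destOK hn'.1 hd (ht hx)
  · exact Eventually.of_forall fun t h1 h2 => absurd ⟨h1, h2⟩ hn'

/-! ### End of the init mode -/

theorem eventually_started (h : e.LiveRun H) (hT : e.Triggered) :
    ∀ᶠ t in atTop, ∀ n, e.Honest n → P.shardOf n = P.source → e.started n t := by
  have := P.finiteNode
  refine eventually_all.2 fun n => ?_
  by_cases hn : e.Honest n ∧ P.shardOf n = P.source
  · obtain ⟨hn, hs⟩ := hn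
    obtain ⟨t, ht⟩ := (h.eventually_seen hn (x := .plan) (by rw [hs]; exact hT)).exists
    obtain ⟨t', ht'⟩ := (h.protocol.source n hn hs).starts t ht
    filter_upwards [eventually_ge_atTop t'] with t₁ h₁ _ _
    exact (h.protocol.source n hn hs).started_mono _ _ h₁ ht'
  · exact Eventually.of_forall fun t h1 h2 => absurd ⟨h1, h2⟩ hn

/-- Once all honest source nodes are in the init mode, the source chain grows by at most one more
block with data transactions. -/
theorem exists_ops_frozen (h : e.LiveRun H) (hT : e.Triggered)
    (hi : ∀ t, ¬HasInit (e.committed P.source t)) :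
    ∃ T, ∀ t ≥ T, ops (e.committed P.source t) = ops (e.committed P.source T) := by
  obtain ⟨t₀, ht₀⟩ := eventually_atTop.1 (h.eventually_started hT)
  set k := (e.ledger P.source t₀).length with hk
  have early : ∀ t, ops (e.committed P.source t) =
      ops ((e.ledger P.source t).take (k + 1)).flatten := by
    intro t
    refine ops_eq_of_forall (flatten_prefix (List.take_prefix _ _)) fun p x hp hx => ?_
    obtain ⟨n, t', pre, post, hn, hs, ht', rfl, hv, hok, -, -⟩ := h.exists_vote hp
    -- A view of more than `k` blocks exists only after `t₀`, when its honest holder has started; it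
    -- is then not in the normal mode, and the dual mode is excluded by `hi`. So data can occur only
    -- in the first `k + 1` blocks.
    have hlen : (e.view n t').length ≤ k := by
      by_contra hlt
      have hst : e.started n t' := by
        refine ht₀ t' (le_of_not_ge fun hle => hlt ?_) n hn hs
        have h1 := (h.consensus.view_le n hn t').length_le
        rw [hs] at h1
        exact h1.trans (h.consensus.ledger_mono _ _ _ hle).length_le
      cases x with
      | data s op seq =>
        rcases (hok rfl).2.2 with ⟨h1, -⟩ | ⟨h1, -⟩
        · exact (sourceMode_normal_iff.1 h1).2.2 hst
        · obtain ⟨-, b, m, hb, -⟩ := sourceMode_dual_iff.1 h1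
          exact hi t ⟨b, m, ((List.prefix_append _ _).trans hp).subset hb⟩
      | _ => simp [Tx.op?] at hx
    have hv' : e.view n t' ++ [pre ++ x :: post] <+: (e.ledger P.source t).take (k + 1) := by
      refine List.prefix_take_iff.2 ⟨hv, ?_⟩
      simpa using hlen
    refine List.IsPrefix.trans ⟨post, ?_⟩ (flatten_prefix hv')
    simp [ChainRun.seen]
  -- The first `k + 1` blocks are fixed once they all exist; otherwise the chain never grows beyond
  -- its `k` blocks at `t₀`.
  by_cases hlong : ∃ T, k + 1 ≤ (e.ledger P.source T).length
  · obtain ⟨T, hT⟩ := hlong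
    refine ⟨T, fun t ht => ?_⟩
    obtain ⟨q, hq⟩ := h.consensus.ledger_mono P.source _ _ ht
    rw [early t, early T, ← hq, List.take_append_of_le_length hT]
  · push Not at hlong
    refine ⟨t₀, fun t ht => ?_⟩
    have hpre := h.consensus.ledger_mono P.source _ _ ht
    have := hlong t
    rw [ChainRun.committed, ChainRun.committed, hpre.eq_of_length (by have := hpre.length_le; omega)]

/-- Otherwise data statements stop at some time `T`. A proposal made from a view containing the
chain at `T` stays valid for every later view, since no data follow its checkpoint. -/
theorem exists_initCtrl (h : e.LiveRun H) (hT : e.Triggered) :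
    ∃ t b m, Tx.initCtrl b m ∈ e.committed P.source t := by
  by_contra hcon
  push Not at hcon
  have hi : ∀ t, ¬HasInit (e.committed P.source t) := fun t ⟨b, m, hb⟩ => hcon t b m hb
  obtain ⟨T, hfrozen⟩ := h.exists_ops_frozen hT hi
  obtain ⟨t₁, ht₁⟩ := hT
  obtain ⟨n, hn, hs⟩ := h.exists_honest_of_mem ht₁
  have hseen : ∀ n', e.Honest n' → P.shardOf n' = P.source → ∀ t,
      e.seen n' t <+: e.committed P.source t := fun n' hn' hs' t => hs' ▸ h.seen_prefix hn' t
  have hev : ∀ᶠ t in atTop, e.started n t ∧ e.ledger P.source T <+: e.view n t :=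
    ((h.eventually_started ⟨t₁, ht₁⟩).mono fun t ht => ht n hn hs).and
      (hs ▸ h.eventually_view hn T)
  obtain ⟨t₂, ht₂⟩ := eventually_atTop.1 hev
  obtain ⟨t₃, ht₃, hp⟩ := (h.protocol.source n hn hs).proposes_init t₂ (ht₂ t₂ le_rfl).1
  have hp := hp.resolve_left fun ⟨b, m, hb⟩ => hcon t₃ b m ((hseen n hn hs t₃).subset hb)
  have hT₃ := (ht₂ t₃ ht₃).2
  have hv₃ : e.view n t₃ <+: e.ledger P.source t₃ := hs ▸ h.consensus.view_le n hn t₃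
  obtain ⟨t, ht⟩ := h.commits hn (by simp [Tx.related, hs]) subset_rfl hp
    (fun n' hn' hs' => by
      filter_upwards [h.eventually_started ⟨t₁, ht₁⟩, h.eventually_view hn' t₃] with t hst hvt _
      have hpre : e.view n t₃ <+: e.view n' t := by
        rw [hs'] at hvt
        exact hv₃.trans hvt
      have hno : ∀ b m, Tx.initCtrl b m ∉ e.seen n' t ++ [] := fun b m hb =>
        hcon t b m ((hseen n' hn' hs' t).subset (by simpa using hb))
      refine ⟨?_, hno, hpre.length_le, ?_, ?_⟩
      · refine sourceMode_init_of_started ?_ (fun ⟨b, m, hb⟩ => hno b m hb) (hst n' hn' hs')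
        intro hd
        exact hi t (((h.sourceChain t)).hasInit_of_dualCtrl
          ((hseen n' hn' hs' t).subset (by simpa using hd)))
      · rw [← List.prefix_iff_eq_take.1 hpre]
      -- Squeeze: the statements seen by `n'` are no more than those at `T`, which are no more than
      -- those in the proposer's view, so the rest of the view of `n'` has none.
      · have hle : ops (e.committed P.source T) <+: ops (e.view n t₃).flatten :=
          ops_prefix (flatten_prefix hT₃)
        have hge : ops (e.seen n' t) <+: ops (e.committed P.source T) := by
          rw [← hfrozen (max t T) (le_max_right _ _)]
          exact ops_prefix ((hseen n' hn' hs' t).trans (h.committed_prefix _ (le_max_left _ _)))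
        obtain ⟨q, hq⟩ := hpre
        rw [← hq, List.drop_left, List.append_nil]
        rw [ChainRun.seen, ← hq, List.flatten_append, ops_append] at hge
        have := (hge.trans hle).length_le
        rw [List.length_append] at this
        exact List.length_eq_zero_iff.1 (by omega))
    (fun _ n' hn' hd' => Eventually.of_forall fun t _ b m hb => by
      rw [List.append_nil] at hb
      obtain ⟨t', ht'⟩ := h.atomicity.atomic _ P.dest t (by simp [Tx.related])
        (hd' ▸ (h.seen_prefix hn' t).subset hb) P.source (by simp [Tx.related])
      exact hcon t' b m ht')
  exact hcon t _ _ (hs ▸ ht)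

/-- A request that is repeated until it is answered is answered. -/
theorem exists_received (h : e.LiveRun H) (hn : e.Honest n) {n₀ : P.Node} (hn₀ : e.Honest n₀)
    {req ans : Msg P} (hreq : ∃ᶠ t in atTop, e.sends n n₀ t req)
    (hans : ∀ᶠ t in atTop, e.delivered n n₀ t req → ∃ t' ≥ t, e.sends n₀ n t' ans) :
    ∃ t, e.Received n t ans := by
  have h1 := h.links n n₀ req hn hn₀ hreq
  have h2 : ∃ᶠ t in atTop, e.sends n₀ n t ans := by
    rw [frequently_atTop]
    intro t
    obtain ⟨t₁, hd, ht₁, hans⟩ := (h1.and_eventually ((eventually_ge_atTop t).and hans)).exists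
    obtain ⟨t₂, ht₂, hs⟩ := hans hd
    exact ⟨t₂, ht₁.trans ht₂, hs⟩
  obtain ⟨t, ht⟩ := (h.links n₀ n ans hn₀ hn h2).exists
  exact ⟨t, t, le_rfl, n₀, ht⟩

/-! ### End of the dual mode -/

theorem holdsCopy_mono (h : e.LiveRun H) (hn : e.Honest n) {T : P.Table} (ht : t ≤ t')
    (hT : e.HoldsCopy H n t (e.seen n t) T) : e.HoldsCopy H n t' (e.seen n t') T := by
  obtain ⟨b, m, h1, h2, h3, h4⟩ := hT
  exact ⟨b, m, (flatten_prefix (h.consensus.view_mono n hn _ _ ht)).subset h1,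
    h.atomicity.confirmed_mono n hn _ _ _ ht h2, h3.mono ht, h4⟩

/-- Once the replying node's view contains the chain at `t`, its first `b` blocks are fixed, so all
its replies are one and the same message, as fairness of links requires. -/
theorem eventually_holdsCopy (h : e.LiveRun H) (hn : e.Honest n) (hd : P.shardOf n = P.dest)
    {b : ℕ} {m : P.Digest} (hb : Tx.initCtrl b m ∈ e.committed P.source t) :
    ∃ T, ∀ᶠ t in atTop, e.HoldsCopy H n t (e.seen n t) T := by
  have hb' : ∃ t, Tx.initCtrl b m ∈ e.committed (P.shardOf n) t :=
    h.atomicity.atomic _ P.source t (by simp [Tx.related]) hb _ (by simp [Tx.related, hd])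
  have hseen := h.eventually_seen hn hb'
  have hconf := h.eventually_confirmed hn hb' (by simp [Tx.related, hd])
  obtain ⟨n₀, hn₀, hs₀⟩ := h.exists_honest_of_mem hb
  obtain ⟨c, h1, h2, h3, -⟩ := (h.sourceChain t).init_spec hb
  suffices ∃ t T, e.HoldsCopy H n t (e.seen n t) T by
    obtain ⟨t₁, T, hT⟩ := this
    refine ⟨T, ?_⟩
    filter_upwards [eventually_ge_atTop t₁] with t' ht'
    exact h.holdsCopy_mono hn ht' hT
  by_contra hno
  push Not at hno
  have hreq : ∃ᶠ t in atTop, e.sends n n₀ t .reqTable := by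
    rw [frequently_atTop]
    intro t₁
    obtain ⟨t₂, ⟨hs, hc⟩, ht₂⟩ := ((hseen.and hconf).and (eventually_ge_atTop t₁)).exists
    obtain ⟨t₃, ht₃, hcase⟩ :=
      (h.protocol.dest n hn hd).requests_table t₂ b m hs hc n₀ hs₀
    exact ⟨t₃, le_trans ht₂ ht₃, hcase.resolve_left fun ⟨T, hT⟩ => hno _ T hT⟩
  obtain ⟨t₁, hrec⟩ := h.exists_received hn hn₀ hreq (ans := .table (tableAfter c.flatten)) (by
    filter_upwards [h.eventually_view hn₀ t] with t₁ hv hdel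
    rw [hs₀] at hv
    obtain ⟨t₂, ht₂, hsend⟩ := (h.protocol.source n₀ hn₀ hs₀).replies_table t₁ n b m hdel
      ((flatten_prefix hv).subset hb)
    rw [← h2, ← List.prefix_iff_eq_take.1 (h1.trans hv)] at hsend
    exact ⟨t₂, ht₂, hsend⟩)
  obtain ⟨t₂, ⟨hs, hc⟩, ht₂⟩ := ((hseen.and hconf).and (eventually_ge_atTop t₁)).exists
  exact hno t₂ _ ⟨b, m, hs, hc, hrec.mono ht₂, h3.symm⟩

/-- If it is never committed, honest source nodes remain in the dual mode once they have the
confirmation, and honest destination nodes keep their copies, so all accept it. -/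
theorem exists_dualCtrl (h : e.LiveRun H) {b : ℕ} {m : P.Digest}
    (hb : Tx.initCtrl b m ∈ e.committed P.source t) :
    ∃ t, Tx.dualCtrl ∈ e.committed P.source t := by
  by_contra hno
  have hnod : ¬∃ t, Tx.dualCtrl ∈ e.committed P.dest t := fun ⟨t, ht⟩ =>
    hno (h.atomicity.atomic _ P.dest t (by simp [Tx.related]) ht _ (by simp [Tx.related]))
  obtain ⟨t₁, hb₁⟩ := h.atomicity.atomic _ P.source t (by simp [Tx.related]) hb P.dest
    (by simp [Tx.related])
  obtain ⟨n, hn, hd⟩ := h.exists_honest_of_mem hb₁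
  have hnseen : ∀ n', e.Honest n' → P.shardOf n' = P.dest → ∀ t, Tx.dualCtrl ∉ e.seen n' t :=
    fun n' hn' hd' t hx => hnod ⟨t, hd' ▸ (h.seen_prefix hn' t).subset hx⟩
  obtain ⟨T, hT⟩ := h.eventually_holdsCopy hn hd hb
  obtain ⟨t₂, ht₂⟩ := hT.exists
  obtain ⟨t₃, -, hp⟩ := (h.protocol.dest n hn hd).proposes_dual t₂ T ht₂
  have hp := hp.resolve_left (hnseen n hn hd t₃)
  refine hnod (hd ▸ h.commits hn (by simp [Tx.related, hd]) subset_rfl hp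
    (fun n' hn' hs' => ?_) (fun _ n' hn' hd' => ?_))
  · have hb' : ∃ t, Tx.initCtrl b m ∈ e.committed (P.shardOf n') t := ⟨t, hs' ▸ hb⟩
    filter_upwards [h.eventually_seen hn' hb',
      h.eventually_confirmed hn' hb' (by simp [Tx.related, hs'])] with t' hs hc hx
    refine sourceMode_dual_iff.2 ⟨by simpa using hx, b, m, by simpa using hs, hc⟩
  · obtain ⟨T', hT'⟩ := h.eventually_holdsCopy hn' hd' hb
    filter_upwards [hT'] with t' hT' hx
    exact ⟨by simpa using hx, T', by simpa using hT'⟩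

theorem exists_totalCtrl (h : e.LiveRun H) (hd : Tx.dualCtrl ∈ e.committed P.source t) :
    ∃ t N, Tx.totalCtrl N ∈ e.committed P.source t := by
  by_contra hno
  push Not at hno
  have hnseen : ∀ n', e.Honest n' → P.shardOf n' = P.source → ∀ t N,
      Tx.totalCtrl N ∉ e.seen n' t :=
    fun n' hn' hs' t N hx => hno t N (hs' ▸ (h.seen_prefix hn' t).subset hx)
  -- All honest source nodes past the dual mode compute the same total, so they accept each other's
  -- proposal.
  have hcount : ∀ n', e.Honest n' → P.shardOf n' = P.source → ∀ t', Tx.dualCtrl ∈ e.seen n' t' →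
      dualCount (e.seen n' t') = dualCount (e.committed P.source t) := by
    intro n' hn' hs' t' hx
    have h1 : e.seen n' t' <+: e.committed P.source (max t t') :=
      (hs' ▸ h.seen_prefix hn' t').trans (h.committed_prefix _ (le_max_right _ _))
    have h2 := h.committed_prefix P.source (le_max_left t t')
    rw [dualCount_eq, dualCount_eq, ← (h.sourceChain _).dualOps_frozen h1 hx,
      ← (h.sourceChain _).dualOps_frozen h2 hd]
  have hev : ∀ n', e.Honest n' → P.shardOf n' = P.source →
      ∀ᶠ t' in atTop, Tx.dualCtrl ∈ e.seen n' t' ∧ e.confirmed n' t' .dualCtrl :=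
    fun n' hn' hs' => (h.eventually_seen hn' ⟨t, hs' ▸ hd⟩).and
      (h.eventually_confirmed hn' ⟨t, hs' ▸ hd⟩ (by simp [Tx.related, hs']))
  obtain ⟨n, hn, hs⟩ := h.exists_honest_of_mem hd
  obtain ⟨t₁, ht₁⟩ := eventually_atTop.1 (hev n hn hs)
  obtain ⟨t₂, ht₂, hp⟩ := (h.protocol.source n hn hs).proposes_total t₁ (ht₁ t₁ le_rfl).1
    (ht₁ t₁ le_rfl).2
  have hp := hp.resolve_left fun ⟨N, hN⟩ => hnseen n hn hs t₂ N hN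
  rw [hcount n hn hs t₂ (ht₁ t₂ ht₂).1] at hp
  obtain ⟨t₃, ht₃⟩ := h.commits hn (by simp [Tx.related, hs]) (by simp [Tx.related]) hp
    (fun n' hn' hs' => by
      filter_upwards [hev n' hn' hs'] with t' ht' _
      refine ⟨sourceMode_ended_iff.2 (by simpa using ht'.1), ht'.2, ?_, ?_⟩
      · simpa using hnseen n' hn' hs' t'
      · rw [List.append_nil, hcount n' hn' hs' t' ht'.1])
    (fun hmem => absurd hmem (by simp [Tx.related, P.source_ne_dest.symm]))
  exact hno t₃ _ (hs ▸ ht₃)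

/-! ### Takeover by the destination -/

theorem holdsProof_mono (h : e.LiveRun H) (hn : e.Honest n) {x : Tx P} (ht : t ≤ t')
    (hx : e.HoldsProof H n t x) : e.HoldsProof H n t' x := by
  obtain ⟨j, path, h1, h2⟩ := hx
  exact ⟨j, path, h1.mono ht, prefix_getElem? (h.consensus.headers_mono n hn _ _ _ ht) h2⟩

/-- A destination node that keeps requesting a committed transaction obtains a proof of it, if
honest source nodes answer. -/
theorem eventually_holdsProof (h : e.LiveRun H) (hn : e.Honest n) {n₀ : P.Node}
    (hn₀ : e.Honest n₀) (hs₀ : P.shardOf n₀ = P.source) {x : Tx P} {req : Msg P}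
    (hx : x ∈ e.committed P.source t)
    (hreq : ∀ᶠ t in atTop, ∃ t' ≥ t, e.HoldsProof H n t' x ∨ e.sends n n₀ t' req)
    (hans : ∀ t, e.delivered n n₀ t req → ∀ (j : ℕ) (B : Block P) (i : ℕ),
      (e.view n₀ t)[j]? = some B → B[i]? = some x →
        ∃ t' ≥ t, e.sends n₀ n t' (.incl x j (merklePath H B i))) :
    ∀ᶠ t in atTop, e.HoldsProof H n t x := by
  suffices ∃ t, e.HoldsProof H n t x by
    obtain ⟨t₁, ht₁⟩ := this
    filter_upwards [eventually_ge_atTop t₁] with t' ht'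
    exact h.holdsProof_mono hn ht' ht₁
  by_contra hno
  push Not at hno
  -- Fixing one occurrence makes all answers the same message.
  obtain ⟨j, B, i, hj, hi⟩ := exists_block_of_mem_committed hx
  have hfreq : ∃ᶠ t in atTop, e.sends n n₀ t req := by
    rw [frequently_atTop]
    intro t₁
    obtain ⟨t₂, ⟨t₃, ht₃, hcase⟩, ht₂⟩ := (hreq.and (eventually_ge_atTop t₁)).exists
    exact ⟨t₃, le_trans ht₂ ht₃, hcase.resolve_left (hno t₃)⟩
  obtain ⟨t₁, hrec⟩ := h.exists_received hn hn₀ hfreq (ans := .incl x j (merklePath H B i)) (by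
    filter_upwards [h.eventually_view hn₀ t] with t₁ hv hdel
    rw [hs₀] at hv
    exact hans t₁ hdel j B i (prefix_getElem? hv hj) hi)
  obtain ⟨t₂, ht₂⟩ := h.live.headers_catch_up n hn P.source t
  refine hno (max t₁ t₂) ⟨j, _, hrec.mono (le_max_left _ _), ?_⟩
  rw [merkle_complete H B i x hi]
  refine prefix_getElem? (ht₂.trans (h.consensus.headers_mono n hn _ _ _ (le_max_right _ _))) ?_
  rw [List.getElem?_map, hj]
  rfl

theorem eventually_serves (h : e.LiveRun H) (hn : e.Honest n) (hd : P.shardOf n = P.dest)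
    {b N : ℕ} {m : P.Digest} (hb : Tx.initCtrl b m ∈ e.committed P.source t)
    (hN : Tx.totalCtrl N ∈ e.committed P.source t) :
    ∀ᶠ t in atTop, ∃ T, e.Serves H n t (e.seen n t) T := by
  obtain ⟨n₀, hn₀, hs₀⟩ := h.exists_honest_of_mem hN
  obtain ⟨hdual, hlen⟩ := (h.sourceChain t).total_spec hN
  have hdest := h.atomicity.atomic _ P.source t (by simp [Tx.related]) hdual P.dest
    (by simp [Tx.related])
  have hseen := h.eventually_seen hn (hd ▸ hdest)
  have hrules := h.protocol.dest n hn hd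
  have hrules₀ := h.protocol.source n₀ hn₀ hs₀
  have htotal : ∀ᶠ t in atTop, e.HoldsProof H n t (.totalCtrl N) := by
    refine h.eventually_holdsProof hn hn₀ hs₀ hN (req := .reqTotal) ?_
      fun t hdel j B i hj hi => hrules₀.replies_total t n hdel j B i N hj hi
    filter_upwards [hseen] with t₁ ht₁
    obtain ⟨t₂, ht₂, hcase⟩ := hrules.requests_total t₁ ht₁ n₀ hs₀
    refine ⟨t₂, ht₂, hcase.imp_left ?_⟩
    -- Requests stop at a proof of any total; all committed totals coincide, so it is a proof of
    -- `N`.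
    rintro ⟨N', hN'⟩
    have h1 := (h.committed_prefix P.source (le_max_right t t₂)).subset
      (h.mem_of_holdsProof hn hN')
    have h2 := (h.committed_prefix P.source (le_max_left t t₂)).subset hN
    rwa [((h.sourceChain _).total_spec h2).2, ← ((h.sourceChain _).total_spec h1).2]
  have hupd : ∀ᶠ t' in atTop, ∀ i : Fin N, ∀ op, (dualOps (e.committed P.source t))[(i : ℕ)]? =
      some op → e.HoldsProof H n t' (.data P.source op (some (i + 1))) := by
    refine eventually_all.2 fun i => ?_
    obtain ⟨op, hop⟩ : ∃ op, (dualOps (e.committed P.source t))[(i : ℕ)]? = some op :=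
      ⟨_, List.getElem?_eq_getElem (hlen ▸ i.2)⟩
    have hmem := (h.sourceChain t).mem_of_dualOps_getElem? hop
    have := h.eventually_holdsProof hn hn₀ hs₀ hmem (req := .reqUpdate (i + 1)) (by
      filter_upwards [htotal] with t₁ ht₁
      obtain ⟨t₂, ht₂, hcase⟩ := hrules.requests_update t₁ N (i + 1) ht₁ (by omega) (by omega)
        n₀ hs₀
      refine ⟨t₂, ht₂, hcase.imp_left ?_⟩
      -- Likewise, the sequence number determines the statement.
      rintro ⟨op', hop'⟩
      have h1 := (h.committed_prefix P.source (le_max_right t t₂)).subset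
        (h.mem_of_holdsProof hn hop')
      have h2 := (h.committed_prefix P.source (le_max_left t t₂)).subset hmem
      obtain ⟨k, hk, h1⟩ := (h.sourceChain _).dualOps_getElem? h1
      obtain ⟨k', hk', h2⟩ := (h.sourceChain _).dualOps_getElem? h2
      obtain rfl : k = k' := by omega
      rwa [Option.some.inj (h2.symm.trans h1)])
      fun t hdel j B i' hj hi => hrules₀.replies_update t n (i + 1) hdel j B i' op hj hi
    filter_upwards [this] with t' ht' op' hop'
    rwa [← Option.some.inj (hop.symm.trans hop')]
  obtain ⟨T, hT⟩ := h.eventually_holdsCopy hn hd hb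
  filter_upwards [hseen, htotal, hupd, hT] with t' h1 h2 h3 h4
  refine ⟨_, h1, T, dualOps (e.committed P.source t), h4, fun k op hk => ?_, hlen ▸ h2, rfl⟩
  exact h3 ⟨k, hlen ▸ (List.getElem?_eq_some_iff.1 hk).1⟩ op hk

theorem terminates (h : e.LiveRun H) (hT : e.Triggered) : e.Terminates H := by
  have := P.finiteNode
  obtain ⟨t₁, b, m, hb⟩ := h.exists_initCtrl hT
  obtain ⟨t₂, hdual⟩ := h.exists_dualCtrl hb
  obtain ⟨t₃, N, hN⟩ := h.exists_totalCtrl hdual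
  have hmono : ∀ {s : P.Shard} {x : Tx P}, (∃ t, x ∈ e.committed s t) →
      ∀ᶠ t in atTop, x ∈ e.committed s t := by
    rintro s x ⟨t, hx⟩
    filter_upwards [eventually_ge_atTop t] with t' ht'
    exact (h.committed_prefix s ht').subset hx
  have hb' := h.atomicity.atomic _ P.source t₁ (by simp [Tx.related]) hb P.dest
    (by simp [Tx.related])
  have hdual' := h.atomicity.atomic _ P.source t₂ (by simp [Tx.related]) hdual P.dest
    (by simp [Tx.related])
  have hsrc : ∀ᶠ t in atTop, ∀ n, e.Honest n → P.shardOf n = P.source →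
      e.sourceMode n t (e.seen n t) = .ended := by
    refine eventually_all.2 fun n => ?_
    by_cases hn : e.Honest n ∧ P.shardOf n = P.source
    · filter_upwards [h.eventually_seen hn.1 ⟨t₂, hn.2 ▸ hdual⟩] with t ht _ _
      exact sourceMode_ended_iff.2 ht
    · exact Eventually.of_forall fun t h1 h2 => absurd ⟨h1, h2⟩ hn
  have hdst : ∀ᶠ t in atTop, ∀ n, e.Honest n → P.shardOf n = P.dest →
      ∃ T, e.Serves H n t (e.seen n t) T := by
    refine eventually_all.2 fun n => ?_
    by_cases hn : e.Honest n ∧ P.shardOf n = P.dest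
    · filter_upwards [h.eventually_serves hn.1 hn.2
        ((h.committed_prefix _ (le_max_left t₁ t₃)).subset hb)
        ((h.committed_prefix _ (le_max_right t₁ t₃)).subset hN)] with t ht _ _
      exact ht
    · exact Eventually.of_forall fun t h1 h2 => absurd ⟨h1, h2⟩ hn
  refine eventually_atTop.1 ?_
  filter_upwards [hmono ⟨t₁, hb⟩, hmono hb', hmono ⟨t₂, hdual⟩, hmono hdual', hmono ⟨t₃, hN⟩,
    hsrc, hdst] with t h1 h2 h3 h4 h5 h6 h7
  exact ⟨⟨b, m, h1, h2⟩, ⟨h3, h4⟩, ⟨N, h5⟩, h6, h7⟩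

end LiveRun

end Execution

end GriDB

theorem theorem2 {P : GriDB.Setting.{u}} (H : GriDB.Hash P)
    (chain : Set (GriDB.ChainRun P)) (v : ℝ) (hchain : GriDB.HasFaultThreshold H chain v)
    (e : GriDB.Execution P) (he : e.toChainRun ∈ chain)
    (hprot : e.FollowsProtocol H) (hlinks : e.FairLinks) (hhash : e.NoCollision H)
    (hmal : e.MaliciousAtMost v) :
    e.SecureMigration H := by
  obtain ⟨hsafe, hlive, hatom⟩ := hchain _ he hmal
  have h : e.LiveRun H := ⟨⟨hsafe, hprot.votes, hhash⟩, hlive, hatom, hprot, hlinks⟩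
  exact ⟨⟨e.serialOrder, h.serializableIsolation hatom, h.durability hatom⟩, h.terminates⟩
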